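/- Let $d\ge 1$, let $\mathbf f=(f_1,\dots,f_d)$ be a vector of formal power series $f_k(z)=\sum_{n\ge0}\phi_{k,n}z^n$ with $\phi_{k,n}\in\mathbb C$, and let $\mathbf m=(m_1,\dots,m_d)\in\mathbb Z_{\ge0}^d\setminus\{\mathbf 0\}$, $|\mathbf m|=m_1+\cdots+m_d$. For each $n\ge\max_k m_k$ let $q_{n,|\mathbf m|}$ be the denominator of an $(n,\mathbf m)$ type II Hermite–Padé approximation of $\mathbf f$, that is, a polynomial $q_{n,|\mathbf m|}\not\equiv0$ of degree at most $|\mathbf m|$ for which there are polynomials $p_1,\dots,p_d$ with $\deg p_k\le n-m_k$ and $q_{n,|\mathbf m|}(z)f_k(z)-p_k(z)=O(z^{n+1})$ (as formal power series), $k=1,\dots,d$, normalized so that its nonzero coefficient of lowest degree equals $1$. (Such a polynomial always exists; if it is not unique, choose any one for each $n$.) Assume that the polynomials $q_{n,|\mathbf m|}$ converge coefficientwise, as $n\to\infty$, to a polynomial $q_{|\mathbf m|}$ with $\deg q_{|\mathbf m|}=|\mathbf m|$ and $q_{|\mathbf m|}(0)=1$. Suppose that $\mathbf f$ is polynomially independent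 with respect to $\mathbf m$: there are no polynomials $p_1,\dots,p_d$, not all zero, with $\deg p_k<m_k$ for all $k$ (so $p_k\equiv 0$ if $m_k=0$), such that $\sum_{k=1}^d p_kf_k$ is a polynomial. Suppose also that the $|\mathbf m|$ zeros of $q_{|\mathbf m|}$, counted with multiplicity, have pairwise distinct absolute values (in particular all of them are simple). Then every zero $\zeta$ of $q_{|\mathbf m|}$ is a system singularity of $(\mathbf f,\mathbf m)$: $\zeta\neq0$ and there are polynomials $p_1,\dots,p_d$ with $\deg p_k<m_k$ for all $k$ such that $\sum_{k=1}^d p_kf_k$ is analytic in the disk $\{z:|z|<|\zeta|\}$ and $\zeta$ is a singular point of it (it has no analytic continuation to a neighborhood of $\zeta$). -/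

import Mathlib

open scoped Topology

namespace HermitePade

/-- `q` is the normalized denominator of some `(n, m)` type II Hermite-Padé approximation of the
vector `f` of formal Taylor series: `q ≠ 0`, `deg q ≤ |m|`, there are polynomials `p k` with
`deg (p k) ≤ n - m k` and `q * f k - p k = O(z ^ (n + 1))`, and the nonzero coefficient of `q` of
lowest degree is `1`. To be used for `n ≥ max m k` only. -/
def IsDenominator {d : ℕ} (f : Fin d → PowerSeries ℂ) (m : Fin d → ℕ) (n : ℕ)
    (q : Polynomial ℂ) : Prop :=
  q ≠ 0 ∧ q.natDegree ≤ ∑ k, m k ∧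
    (∃ p : Fin d → Polynomial ℂ, ∀ k, (p k).natDegree ≤ n - m k ∧
      (PowerSeries.X : PowerSeries ℂ) ^ (n + 1) ∣
        (q : PowerSeries ℂ) * f k - (p k : PowerSeries ℂ)) ∧
    q.trailingCoeff = 1

/-- The combination `∑ k, p k * f k`, as a formal power series. -/
noncomputable def combination {d : ℕ} (f : Fin d → PowerSeries ℂ)
    (p : Fin d → Polynomial ℂ) : PowerSeries ℂ :=
  ∑ k, (p k : PowerSeries ℂ) * f k

/-- `deg (p k) < m k` for all `k`; in particular `p k = 0` when `m k = 0`. -/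
def DegreesBelow {d : ℕ} (m : Fin d → ℕ) (p : Fin d → Polynomial ℂ) : Prop :=
  ∀ k, (p k).degree < (m k : WithBot ℕ)

/-- `f` is polynomially independent with respect to `m`. -/
def PolynomiallyIndependent {d : ℕ} (f : Fin d → PowerSeries ℂ) (m : Fin d → ℕ) : Prop :=
  ¬ ∃ p : Fin d → Polynomial ℂ, (∃ k, p k ≠ 0) ∧ DegreesBelow m p ∧
    ∃ P : Polynomial ℂ, combination f p = (P : PowerSeries ℂ)

/-- The formal Taylor series `F` defines an analytic function in the disk `|z| < R`, that is,
it converges there. -/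
def AnalyticInDisk (F : PowerSeries ℂ) (R : ℝ) : Prop :=
  ∀ z ∈ Metric.ball (0 : ℂ) R, Summable fun n : ℕ => PowerSeries.coeff n F * z ^ n

/-- For `F` analytic in the disk `|z| < |ξ|`: the boundary point `ξ` is a singular point of `F`,
that is, no function analytic at `ξ` coincides with (the sum of) `F` on the part of the disk that
is close to `ξ`. -/
def IsSingularPoint (F : PowerSeries ℂ) (ξ : ℂ) : Prop :=
  ¬ ∃ h : ℂ → ℂ, AnalyticAt ℂ h ξ ∧
    ∀ᶠ z in 𝓝[Metric.ball (0 : ℂ) ‖ξ‖] ξ,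
      HasSum (fun n : ℕ => PowerSeries.coeff n F * z ^ n) (h z)

/-- `ξ` is a system singularity of `(f, m)`. -/
def IsSystemSingularity {d : ℕ} (f : Fin d → PowerSeries ℂ) (m : Fin d → ℕ) (ξ : ℂ) : Prop :=
  ξ ≠ 0 ∧ ∃ p : Fin d → Polynomial ℂ, DegreesBelow m p ∧
    AnalyticInDisk (combination f p) ‖ξ‖ ∧ IsSingularPoint (combination f p) ξ

end HermitePade

/-! Let $N=|\mathbf m|$. The Padé conditions say that the coefficient of $z^n$ in $q_n\cdot z^s f_k$
vanishes for $s<m_k$. Hence the coefficient sequences of all combinations $\sum p_kf_k$ satisfy one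
linear recurrence of order $N$, whose coefficients converge and whose limiting characteristic
polynomial, the reversal of $q_{|\mathbf m|}$, has the zeros $1/\zeta$. Polynomial independence
makes these sequences an $N$-dimensional space in which no nonzero element vanishes eventually.
Perron's theorem (`exists_solution_tendsto_ratio`) uses the distinct moduli to find, for each zero
$\zeta$, a combination whose successive coefficients have ratio tending to $1/\zeta$. Fabry's ratio
theorem (`isSingularPoint_of_tendsto_ratio`) then makes $\zeta$ a singular point on its circle of
convergence. For Fabry's theorem, rescale $\zeta$ to $1$. If the series continued past $1$, Euler's
transform would give $\sum_k\binom nk a_ke^{ku}=O(r^{-n})$ with $r>1/2$, uniformly in small $u$.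
Derivatives in $u$ allow polynomial weights in $k$. As $a_k$ turns slowly, some real linear form of
$a_k$ has few sign changes, and a polynomial with zeros there makes all terms with $n=2c$
nonnegative. The middle term, about $4^c|a_c|$, is then too large. -/

namespace HermitePade

open Filter Metric

/-! ### Euler transforms and continuation past the point 1 -/

/-- Cauchy's estimate for the coefficients of a convergent expansion at the origin. -/
theorem norm_coeff_le_of_hasSum {G : ℂ → ℂ} {b : ℕ → ℂ} {r M : ℝ} (hr : 0 < r)
    (hG : DifferentiableOn ℂ G (closedBall 0 r)) (hM : ∀ w ∈ sphere (0 : ℂ) r, ‖G w‖ ≤ M)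
    (hb : ∀ᶠ w in 𝓝 (0 : ℂ), HasSum (fun n => b n * w ^ n) (G w)) (n : ℕ) :
    ‖b n‖ ≤ M / r ^ n := by
  lift r to NNReal using hr.le
  have h1 := (hG.hasFPowerSeriesOnBall (by exact_mod_cast hr)).hasFPowerSeriesAt
  have h2 : HasFPowerSeriesAt G (FormalMultilinearSeries.ofScalars ℂ b) 0 := by
    rw [hasFPowerSeriesAt_iff]
    filter_upwards [hb] with w hw
    simpa [mul_comm] using hw
  have h3 := h1.eq_formalMultilinearSeries h2
  have h4 := norm_cauchyPowerSeries_le G 0 r n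
  rw [h3, FormalMultilinearSeries.ofScalars_norm] at h4
  refine h4.trans ?_
  have h5 : ∫ θ : ℝ in 0..2 * Real.pi, ‖G (circleMap 0 r θ)‖ ≤ M * (2 * Real.pi) := by
    have := intervalIntegral.norm_integral_le_of_norm_le_const (a := 0) (b := 2 * Real.pi)
      (f := fun θ => ‖G (circleMap 0 r θ)‖) (C := M) (by
        intro θ _
        rw [norm_norm]
        exact hM _ (circleMap_mem_sphere _ hr.le _))
    rw [sub_zero, abs_of_pos Real.two_pi_pos] at this
    exact (Real.le_norm_self _).trans this
  have h6 : (2 * Real.pi)⁻¹ * ∫ θ : ℝ in 0..2 * Real.pi, ‖G (circleMap 0 r θ)‖ ≤ M := by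
    rw [inv_mul_le_iff₀ Real.two_pi_pos]
    linarith
  calc _ ≤ M * |(r : ℝ)|⁻¹ ^ n := by gcongr
    _ = M / (r : ℝ) ^ n := by rw [abs_of_pos hr, inv_pow, div_eq_mul_inv]

theorem hasSum_choose_mul_pow (k : ℕ) {w : ℂ} (hw : ‖w‖ < 1) :
    HasSum (fun n : ℕ => (n.choose k : ℂ) * w ^ n) (w ^ k / (1 - w) ^ (k + 1)) := by
  have h := (hasSum_choose_mul_geometric_of_norm_lt_one k hw).mul_left (w ^ k)
  have h' := (add_left_injective k).hasSum_iff (f := fun n : ℕ => (n.choose k : ℂ) * w ^ n)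
    (a := w ^ k / (1 - w) ^ (k + 1)) (by
      intro n hn
      have : n < k := by
        by_contra! hkn
        exact hn ⟨n - k, Nat.sub_add_cancel hkn⟩
      simp [Nat.choose_eq_zero_of_lt this])
  rw [← h']
  have e1 : w ^ k * (1 / (1 - w) ^ (k + 1)) = w ^ k / (1 - w) ^ (k + 1) := by ring
  rw [e1] at h
  refine h.congr_fun fun n => ?_
  simp only [Function.comp]
  ring

/-- Euler's transformation of a power series. -/
theorem hasSum_euler {b : ℕ → ℂ} {w s : ℂ} {C K : ℝ} (hK : 0 ≤ K)
    (hb : ∀ k, ‖b k‖ ≤ C * K ^ k) (hw : ‖w‖ * (1 + K) < 1)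
    (hs : HasSum (fun k => b k * (w / (1 - w)) ^ k) s) :
    HasSum (fun n => (∑ k ∈ Finset.range (n + 1), (n.choose k : ℂ) * b k) * w ^ n)
      ((1 - w)⁻¹ * s) := by
  have hw1 : ‖w‖ < 1 := by nlinarith [norm_nonneg w]
  let F : ℕ × ℕ → ℂ := fun p => ((p.1.choose p.2 : ℕ) : ℂ) * b p.2 * w ^ p.1
  have hzero : ∀ n k : ℕ, k ∉ Finset.range (n + 1) → F (n, k) = 0 := by
    intro n k hk
    have : n < k := by
      rw [Finset.mem_range] at hk
      omega
    simp [F, Nat.choose_eq_zero_of_lt this]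
  -- Absolute convergence of the double series, by $\sum_k\binom nk K^k=(1+K)^n$; summing by rows
  -- and by columns gives the two sides.
  have hF : Summable F := by
    apply Summable.of_norm
    rw [summable_prod_of_nonneg (fun _ => norm_nonneg _)]
    have hfin : ∀ n, HasSum (fun k => ‖F (n, k)‖) (∑ k ∈ Finset.range (n + 1), ‖F (n, k)‖) :=
      fun n => hasSum_sum_of_ne_finset_zero fun k hk => by simp [hzero n k hk]
    refine ⟨fun n => (hfin n).summable, ?_⟩
    have hgeo : Summable fun n : ℕ => C * (‖w‖ * (1 + K)) ^ n :=
      (summable_geometric_of_lt_one (by positivity) hw).mul_left _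
    refine hgeo.of_nonneg_of_le (fun n => tsum_nonneg fun _ => norm_nonneg _) fun n => ?_
    rw [(hfin n).tsum_eq]
    calc ∑ k ∈ Finset.range (n + 1), ‖F (n, k)‖
        ≤ ∑ k ∈ Finset.range (n + 1), (n.choose k : ℝ) * (C * K ^ k) * ‖w‖ ^ n := by
          refine Finset.sum_le_sum fun k _ => ?_
          simp only [F, norm_mul, norm_pow, Complex.norm_natCast]
          gcongr
          exact hb k
      _ = C * (‖w‖ * (1 + K)) ^ n := by
          rw [mul_pow, add_comm 1 K, add_pow, Finset.mul_sum, Finset.mul_sum]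
          refine Finset.sum_congr rfl fun k _ => ?_
          simp only [one_pow]
          ring
  have h1 : HasSum (fun n => (∑ k ∈ Finset.range (n + 1), (n.choose k : ℂ) * b k) * w ^ n)
      (∑' p, F p) := by
    refine hF.hasSum.prod_fiberwise fun n => ?_
    rw [Finset.sum_mul]
    exact hasSum_sum_of_ne_finset_zero (hzero n)
  have h2 : HasSum (fun k => b k * (w ^ k / (1 - w) ^ (k + 1))) (∑' p, F p) := by
    have h3 := (Equiv.prodComm ℕ ℕ).hasSum_iff.2 hF.hasSum
    refine h3.prod_fiberwise fun k => ?_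
    refine ((hasSum_choose_mul_pow k hw1).mul_left (b k)).congr_fun fun n => ?_
    simp only [F, Function.comp, Equiv.prodComm_apply, Prod.swap_prod_mk]
    ring
  have h4 := hs.mul_left (1 - w)⁻¹
  have h5 : ∑' p, F p = (1 - w)⁻¹ * s := by
    refine h2.unique ?_
    refine h4.congr_fun fun k => ?_
    rw [div_pow, pow_succ, div_eq_mul_inv, div_eq_mul_inv, mul_inv]
    ring
  rwa [h5] at h1

/-- Exponential bounds for the Euler transforms of `a k * exp (k * u)`, uniform in small `u`. -/
def EulerBound (a : ℕ → ℂ) (r ρ M : ℝ) : Prop :=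
  ∀ (n : ℕ) (u : ℂ), ‖u‖ ≤ ρ →
    ‖∑ k ∈ Finset.range (n + 1), (n.choose k : ℂ) * (a k * Complex.exp (k * u))‖ ≤ M / r ^ n

/-- Pascal's rule: the transform of the shifted sequence is $e^{-u}$ times the difference of the
transforms of orders $n+1$ and $n$. Iterated, this allows finitely many initial terms to be
discarded. -/
theorem EulerBound.shift {a : ℕ → ℂ} {r ρ M : ℝ} (hr : 0 < r) (h : EulerBound a r ρ M) :
    EulerBound (fun k => a (k + 1)) r ρ (Real.exp ρ * (M / r + M)) := by
  intro n u hu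
  have key : ∑ k ∈ Finset.range (n + 1), (n.choose k : ℂ) * (a (k + 1) * Complex.exp (k * u)) =
      Complex.exp (-u) *
        (∑ k ∈ Finset.range (n + 1 + 1), ((n + 1).choose k : ℂ) * (a k * Complex.exp (k * u)) -
        ∑ k ∈ Finset.range (n + 1), (n.choose k : ℂ) * (a k * Complex.exp (k * u))) := by
    have e1 : ∑ k ∈ Finset.range (n + 1), (n.choose k : ℂ) * (a k * Complex.exp (k * u)) =
        ∑ k ∈ Finset.range (n + 1 + 1), (n.choose k : ℂ) * (a k * Complex.exp (k * u)) := by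
      rw [Finset.sum_range_succ _ (n + 1)]
      simp
    rw [e1, ← Finset.sum_sub_distrib, Finset.sum_range_succ' _ (n + 1), mul_add, Finset.mul_sum]
    simp only [Nat.choose_zero_right, sub_self, mul_zero, add_zero]
    refine Finset.sum_congr rfl fun k _ => ?_
    rw [Nat.choose_succ_succ]
    have : Complex.exp ((k + 1 : ℕ) * u) = Complex.exp (k * u) * Complex.exp u := by
      rw [← Complex.exp_add]
      push_cast
      ring_nf
    rw [this]
    have h2 : Complex.exp (-u) * Complex.exp u = 1 := by rw [← Complex.exp_add]; simp
    push_cast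
    linear_combination (-(n.choose k : ℂ) * a (k + 1) * Complex.exp (k * u)) * h2
  rw [key, norm_mul]
  have h1 : ‖Complex.exp (-u)‖ ≤ Real.exp ρ := by
    rw [Complex.norm_exp]
    exact Real.exp_le_exp.2 ((Complex.re_le_norm _).trans (by simpa using hu))
  calc _ ≤ Real.exp ρ * (M / r ^ (n + 1) + M / r ^ n) := by
        gcongr
        exact (norm_sub_le _ _).trans (add_le_add (h (n + 1) u hu) (h n u hu))
    _ = _ := by
      rw [pow_succ]
      field_simp

theorem EulerBound.iterate_shift {a : ℕ → ℂ} {r ρ M : ℝ} (hr : 0 < r) (h : EulerBound a r ρ M)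
    (j : ℕ) : ∃ M', EulerBound (fun k => a (k + j)) r ρ M' := by
  induction j with
  | zero => exact ⟨M, h⟩
  | succ j ih =>
    obtain ⟨M', hM'⟩ := ih
    have e : (fun k => a (k + (j + 1))) = fun k => a (k + 1 + j) := by
      funext k
      congr 1
      ring
    exact ⟨_, e ▸ hM'.shift hr⟩

theorem exists_norm_le_two_pow {a : ℕ → ℂ}
    (ha : ∀ z ∈ ball (0 : ℂ) 1, Summable fun n : ℕ => a n * z ^ n) :
    ∃ C, ∀ n, ‖a n‖ ≤ C * 2 ^ n := by
  have h := (ha (1 / 2) (by norm_num)).tendsto_atTop_zero.norm.bddAbove_range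
  obtain ⟨C, hC⟩ := h
  refine ⟨C, fun n => ?_⟩
  have := hC ⟨n, rfl⟩
  dsimp only at this
  rw [norm_mul, norm_pow, norm_div, norm_one, Complex.norm_ofNat, one_div, inv_pow,
    ← div_eq_mul_inv, div_le_iff₀ (by positivity)] at this
  exact this

theorem differentiableOn_tsum_mul_pow {a : ℕ → ℂ}
    (ha : ∀ z ∈ ball (0 : ℂ) 1, Summable fun n : ℕ => a n * z ^ n) :
    DifferentiableOn ℂ (fun z => ∑' n, a n * z ^ n) (ball 0 1) := by
  intro z hz
  obtain ⟨s, hs1, hs2⟩ := exists_between (mem_ball_zero_iff.1 hz)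
  have hs0 : 0 < s := (norm_nonneg z).trans_lt hs1
  have h1 : Summable fun n => ‖a n * (s : ℂ) ^ n‖ :=
    (ha s (by simpa [abs_of_pos hs0] using hs2)).norm
  refine ((Complex.differentiableOn_tsum_of_summable_norm (U := ball 0 s) h1
    (fun n => by fun_prop) isOpen_ball fun n w hw => ?_).differentiableAt
    (isOpen_ball.mem_nhds (by simpa using hs1))).differentiableWithinAt
  rw [norm_mul, norm_mul, norm_pow, norm_pow, Complex.norm_real, Real.norm_of_nonneg hs0.le]
  gcongr
  exact (mem_ball_zero_iff.1 hw).le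

theorem norm_le_norm_one_sub {w : ℂ} (hw : ‖w‖ ≤ 1 / 2) : ‖w‖ ≤ ‖1 - w‖ := by
  have := norm_sub_norm_le 1 w
  rw [norm_one] at this
  linarith

/-- The hypothesis says that `∑ a n * z ^ n` is analytic in the unit disk and at the point `1`. -/
theorem exists_eulerBound {a : ℕ → ℂ}
    (ha : ∀ z ∈ ball (0 : ℂ) 1, Summable fun n : ℕ => a n * z ^ n)
    {h : ℂ → ℂ} (hh : AnalyticAt ℂ h 1)
    (hah : ∀ᶠ z in 𝓝[ball (0 : ℂ) 1] 1, HasSum (fun n : ℕ => a n * z ^ n) (h z)) :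
    ∃ r ρ M, 1 / 2 < r ∧ 0 < ρ ∧ EulerBound a r ρ M := by
  classical
  obtain ⟨η, hη, hU⟩ : ∃ η > 0, ∀ z ∈ ball (1 : ℂ) η, AnalyticAt ℂ h z ∧
      (z ∈ ball (0 : ℂ) 1 → HasSum (fun n : ℕ => a n * z ^ n) (h z)) := by
    have := hh.eventually_analyticAt.and (eventually_nhdsWithin_iff.1 hah)
    exact Metric.eventually_nhds_iff_ball.1 this
  let g : ℂ → ℂ := fun z => if z ∈ ball (0 : ℂ) 1 then ∑' n, a n * z ^ n else h z
  let U : Set ℂ := ball 0 1 ∪ ball 1 η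
  have hUo : IsOpen U := isOpen_ball.union isOpen_ball
  have hg1 : ∀ z ∈ ball (0 : ℂ) 1, g z = ∑' n, a n * z ^ n := fun z hz => if_pos hz
  have hg2 : ∀ z ∈ ball (1 : ℂ) η, g z = h z := by
    intro z hz
    by_cases hz1 : z ∈ ball (0 : ℂ) 1
    · rw [hg1 z hz1, ((hU z hz).2 hz1).tsum_eq]
    · exact if_neg hz1
  have hg : ∀ z ∈ U, DifferentiableAt ℂ g z := by
    rintro z (hz | hz)
    · refine DifferentiableAt.congr_of_eventuallyEq
        ((differentiableOn_tsum_mul_pow ha).differentiableAt (isOpen_ball.mem_nhds hz)) ?_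
      filter_upwards [isOpen_ball.mem_nhds hz] with y hy using hg1 y hy
    · refine DifferentiableAt.congr_of_eventuallyEq (hU z hz).1.differentiableAt ?_
      filter_upwards [isOpen_ball.mem_nhds hz] with y hy using hg2 y hy
  -- The transforms of $a_ke^{ku}$ have the generating function $(1-w)^{-1}g(\varphi(u,w))$. It is
  -- enough that $\varphi$ maps a neighbourhood of $\{0\}\times\{|w|\le 1/2\}$ into the domain $U$
  -- of the continuation $g$.
  let φ : ℂ × ℂ → ℂ := fun p => Complex.exp p.1 * (p.2 / (1 - p.2))
  let O : Set (ℂ × ℂ) := {p | p.2 ≠ 1} ∩ φ ⁻¹' U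
  have hne : IsOpen {p : ℂ × ℂ | p.2 ≠ 1} := isOpen_ne_fun continuous_snd continuous_const
  have hφ : ContinuousOn φ {p | p.2 ≠ 1} := by
    intro p hp
    refine ContinuousAt.continuousWithinAt ?_
    have : (1 : ℂ) - p.2 ≠ 0 := sub_ne_zero.2 (Ne.symm hp)
    fun_prop (disch := assumption)
  have hO : IsOpen O := hφ.isOpen_inter_preimage hne hUo
  have hK : IsCompact ({0} ×ˢ closedBall 0 (1 / 2) : Set (ℂ × ℂ)) :=
    isCompact_singleton.prod (isCompact_closedBall _ _)
  have hKO : ({0} ×ˢ closedBall 0 (1 / 2) : Set (ℂ × ℂ)) ⊆ O := by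
    rintro ⟨u, w⟩ ⟨hu, hw⟩
    simp only [Set.mem_singleton_iff] at hu
    subst hu
    have hw' : ‖w‖ ≤ 1 / 2 := by simpa using hw
    have hw1 : w ≠ 1 := by
      rintro rfl
      norm_num at hw'
    refine ⟨hw1, ?_⟩
    have h1w : (1 : ℂ) - w ≠ 0 := sub_ne_zero.2 (Ne.symm hw1)
    simp only [φ, Set.mem_preimage, Complex.exp_zero, one_mul]
    have hle : ‖w / (1 - w)‖ ≤ 1 := by
      rw [norm_div]
      exact div_le_one_of_le₀ (norm_le_norm_one_sub hw') (norm_nonneg _)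
    -- The disk $|w|\le1/2$ touches the line $|w|=|1-w|$ only at $w=1/2$, which is sent to $1$,
    -- where $h$ takes over.
    rcases hle.lt_or_eq with hlt | heq
    · exact Or.inl (by simpa using hlt)
    · right
      have h2 : ‖w‖ = ‖1 - w‖ := by
        rw [norm_div, div_eq_one_iff_eq (norm_ne_zero_iff.2 h1w)] at heq
        exact heq
      have h3 : w = 1 / 2 := by
        have h4 : ‖1 - w‖ ≤ 1 / 2 := h2 ▸ hw'
        have e1 := Complex.sq_norm w
        have e2 := Complex.sq_norm (1 - w)
        rw [Complex.normSq_apply] at e1 e2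
        simp only [Complex.sub_re, Complex.one_re, Complex.sub_im, Complex.one_im] at e2
        have h5 : w.re = 1 / 2 := by rw [← h2] at e2; nlinarith
        have h6 : w.im = 0 := by
          have : ‖w‖ ^ 2 ≤ (1 / 2) ^ 2 := by gcongr
          have : w.im * w.im ≤ 0 := by rw [e1, h5] at this; nlinarith
          nlinarith [mul_self_nonneg w.im, mul_self_eq_zero.1 (le_antisymm this (mul_self_nonneg _))]
        apply Complex.ext <;> simp [h5, h6]
      rw [h3]
      norm_num [hη]
  obtain ⟨δ, hδ, hδO⟩ := hK.exists_cthickening_subset_open hO hKO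
  let ρ := min δ 1
  let r := 1 / 2 + min δ (1 / 4)
  have hρ : 0 < ρ := lt_min hδ one_pos
  have hr : 1 / 2 < r := by
    have : 0 < min δ (1 / 4) := lt_min hδ (by norm_num)
    simp only [r]
    linarith
  have hmem : ∀ u w : ℂ, ‖u‖ ≤ ρ → ‖w‖ ≤ r → (u, w) ∈ O := by
    intro u w hu hw
    apply hδO
    obtain ⟨w', hw', hww'⟩ : ∃ w' : ℂ, ‖w'‖ ≤ 1 / 2 ∧ dist w w' ≤ δ := by
      by_cases hc : ‖w‖ ≤ 1 / 2
      · exact ⟨w, hc, by simpa using hδ.le⟩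
      · push Not at hc
        have hw0 : 0 < ‖w‖ := lt_trans (by norm_num) hc
        refine ⟨((1 / 2 / ‖w‖ : ℝ) : ℂ) * w, ?_, ?_⟩
        · rw [norm_mul, Complex.norm_real, Real.norm_of_nonneg (by positivity)]
          field_simp
          exact le_rfl
        · have : w - ((1 / 2 / ‖w‖ : ℝ) : ℂ) * w = ((1 - 1 / 2 / ‖w‖ : ℝ) : ℂ) * w := by
            push_cast
            ring
          rw [dist_eq_norm, this, norm_mul, Complex.norm_real, Real.norm_of_nonneg]
          · have : (1 - 1 / 2 / ‖w‖) * ‖w‖ = ‖w‖ - 1 / 2 := by field_simp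
            rw [this]
            have := min_le_left δ (1 / 4)
            simp only [r] at hw
            linarith
          · rw [sub_nonneg, div_le_one hw0]
            exact hc.le
    refine mem_cthickening_of_dist_le _ (0, w') _ _ ⟨rfl, by simpa using hw'⟩ ?_
    rw [Prod.dist_eq]
    exact max_le (by simpa using hu.trans (min_le_left _ _)) hww'
  let G : ℂ → ℂ → ℂ := fun u w => (1 - w)⁻¹ * g (φ (u, w))
  have hcont : ContinuousOn (fun p : ℂ × ℂ => G p.1 p.2) (closedBall 0 ρ ×ˢ closedBall 0 r) := by
    rintro ⟨u, w⟩ ⟨hu, hw⟩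
    have hm := hmem u w (by simpa using hu) (by simpa using hw)
    refine ContinuousAt.continuousWithinAt ?_
    have h1w : (1 : ℂ) - w ≠ 0 := sub_ne_zero.2 (Ne.symm hm.1)
    have h1 : ContinuousAt φ (u, w) := hφ.continuousAt (hne.mem_nhds hm.1)
    have h2 : ContinuousAt g (φ (u, w)) := (hg _ hm.2).continuousAt
    have h3 : ContinuousAt (fun p : ℂ × ℂ => g (φ p)) (u, w) :=
      ContinuousAt.comp (f := φ) (g := g) h2 h1
    have h4 : ContinuousAt (fun p : ℂ × ℂ => (1 - p.2)⁻¹) (u, w) :=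
      ContinuousAt.inv₀ (by fun_prop) h1w
    exact h4.mul h3
  obtain ⟨M, hM⟩ := ((isCompact_closedBall (0 : ℂ) ρ).prod
    (isCompact_closedBall (0 : ℂ) r)).exists_bound_of_continuousOn hcont
  obtain ⟨C, hC⟩ := exists_norm_le_two_pow ha
  refine ⟨r, ρ, M, hr, hρ, fun n u hu => ?_⟩
  have hr0 : 0 < r := lt_trans (by norm_num) hr
  have hexp : ‖Complex.exp u‖ ≤ 3 := by
    rw [Complex.norm_exp]
    have : u.re ≤ 1 := (Complex.re_le_norm u).trans (hu.trans (min_le_right _ _))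
    exact (Real.exp_le_exp.2 this).trans Real.exp_one_lt_three.le
  refine norm_coeff_le_of_hasSum (G := G u)
    (b := fun n => ∑ k ∈ Finset.range (n + 1), (n.choose k : ℂ) * (a k * Complex.exp (k * u)))
    hr0 ?_ ?_ ?_ n
  · intro w hw
    have hm := hmem u w hu (by simpa using hw)
    have h1w : (1 : ℂ) - w ≠ 0 := sub_ne_zero.2 (Ne.symm hm.1)
    refine DifferentiableAt.differentiableWithinAt ?_
    have h1 : DifferentiableAt ℂ (fun w => φ (u, w)) w := by
      simp only [φ]
      fun_prop (disch := assumption)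
    have h2 : DifferentiableAt ℂ (fun w => g (φ (u, w))) w :=
      DifferentiableAt.comp (f := fun w => φ (u, w)) (g := g) w (hg _ hm.2) h1
    have h4 : DifferentiableAt ℂ (fun w : ℂ => (1 - w)⁻¹) w := by
      fun_prop (disch := assumption)
    exact h4.mul h2
  · intro w hw
    exact hM (u, w) ⟨by simpa using hu, sphere_subset_closedBall hw⟩
  -- With $|a_k|\le C2^k$ and $|e^u|\le3$ the growth rate is $K=6$, so Euler's transformation
  -- requires $|w|<1/(1+K)=1/7$.
  · filter_upwards [ball_mem_nhds (0 : ℂ) (show (0 : ℝ) < 1 / 7 by norm_num)] with w hw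
    have hw' : ‖w‖ < 1 / 7 := by simpa using hw
    have h1w : 6 / 7 ≤ ‖1 - w‖ := by
      have := norm_sub_norm_le 1 w
      rw [norm_one] at this
      linarith
    have hball : φ (u, w) ∈ ball (0 : ℂ) 1 := by
      simp only [φ, mem_ball_zero_iff, norm_mul, norm_div]
      calc ‖Complex.exp u‖ * (‖w‖ / ‖1 - w‖) ≤ 3 * ((1 / 7) / (6 / 7)) := by gcongr
        _ < 1 := by norm_num
    refine hasSum_euler (C := C) (K := 6) (by norm_num) (fun k => ?_) (by linarith) ?_
    · rw [norm_mul, show (6 : ℝ) = 2 * 3 by norm_num, mul_pow, ← mul_assoc, Complex.exp_nat_mul,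
        norm_pow]
      gcongr
      · exact (norm_nonneg _).trans (hC k)
      · exact hC k
    · simp only [G] at *
      rw [hg1 _ hball]
      refine (ha _ hball).hasSum.congr_fun fun k => ?_
      simp only [φ]
      rw [mul_pow, Complex.exp_nat_mul]
      ring

/-! ### Polynomial weights and sign changes -/

/-- The moments are the derivatives at $u=0$ of the transform times $e^{-cu}$, so Cauchy's estimate
on $|u|=\rho$ applies. -/
theorem EulerBound.norm_moment_le {a : ℕ → ℂ} {r ρ M : ℝ} (hρ : 0 < ρ) (h : EulerBound a r ρ M)
    (n c j : ℕ) :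
    ‖∑ k ∈ Finset.range (n + 1), (n.choose k * a k : ℂ) * ((k : ℂ) - c) ^ j‖ ≤
      j.factorial * (M / r ^ n * Real.exp (ρ * c)) / ρ ^ j := by
  let g : ℂ → ℂ := fun u => ∑ k ∈ Finset.range (n + 1),
    (n.choose k * a k : ℂ) * Complex.exp (((k : ℂ) - c) * u)
  have hg : Differentiable ℂ g := by
    simp only [g]
    fun_prop
  have h1 : iteratedDeriv j g 0 =
      ∑ k ∈ Finset.range (n + 1), (n.choose k * a k : ℂ) * ((k : ℂ) - c) ^ j := by
    simp only [g]
    rw [iteratedDeriv_fun_sum (fun k _ => by fun_prop)]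
    refine Finset.sum_congr rfl fun k _ => ?_
    rw [iteratedDeriv_const_mul_field, iteratedDeriv_cexp_const_mul]
    simp
  rw [← h1]
  refine Complex.norm_iteratedDeriv_le_of_forall_mem_sphere_norm_le j hρ hg.diffContOnCl ?_
  intro u hu
  have hu' : ‖u‖ = ρ := by simpa using hu
  have h2 : g u = Complex.exp (-(c * u)) *
      ∑ k ∈ Finset.range (n + 1), (n.choose k : ℂ) * (a k * Complex.exp (k * u)) := by
    simp only [g]
    rw [Finset.mul_sum]
    refine Finset.sum_congr rfl fun k _ => ?_
    rw [sub_mul, sub_eq_neg_add, Complex.exp_add]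
    ring
  rw [h2, norm_mul, mul_comm]
  refine mul_le_mul (h n u hu'.le) ?_ (norm_nonneg _) ((norm_nonneg _).trans (h n u hu'.le))
  rw [Complex.norm_exp, Real.exp_le_exp]
  refine (Complex.re_le_norm _).trans ?_
  rw [norm_neg, norm_mul, Complex.norm_natCast, hu', mul_comm]

/-- Expand the product over subsets $t\subseteq S$. Since $|t|\le n$, the factorial $|t|!$ is at
most $n^{|t|}$, and the bounds reassemble into a product. -/
theorem norm_sum_mul_prod_le {s : Finset ℕ} {W x : ℕ → ℂ} {A ρ : ℝ} (hρ : 0 < ρ) (hA : 0 ≤ A)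
    (hW : ∀ j : ℕ, ‖∑ k ∈ s, W k * x k ^ j‖ ≤ j.factorial * A / ρ ^ j)
    {S : Finset ℕ} {n : ℕ} (hS : S.card ≤ n) (ν : ℕ → ℂ) :
    ‖∑ k ∈ s, W k * ∏ l ∈ S, (1 - ν l * x k)‖ ≤ A * ∏ l ∈ S, (1 + n * ‖ν l‖ / ρ) := by
  have h1 : ∑ k ∈ s, W k * ∏ l ∈ S, (1 - ν l * x k) =
      ∑ t ∈ S.powerset, (∏ l ∈ t, -ν l) * ∑ k ∈ s, W k * x k ^ t.card := by
    simp_rw [sub_eq_add_neg, Finset.prod_one_add, Finset.mul_sum]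
    rw [Finset.sum_comm]
    refine Finset.sum_congr rfl fun t _ => Finset.sum_congr rfl fun k _ => ?_
    have : ∏ l ∈ t, -(ν l * x k) = (∏ l ∈ t, -ν l) * x k ^ t.card := by
      rw [← Finset.prod_const, ← Finset.prod_mul_distrib]
      exact Finset.prod_congr rfl fun _ _ => by ring
    rw [this]
    ring
  rw [h1, Finset.prod_one_add, Finset.mul_sum]
  refine (norm_sum_le _ _).trans (Finset.sum_le_sum fun t ht => ?_)
  have ht' : t.card ≤ n := (Finset.card_le_card (Finset.mem_powerset.1 ht)).trans hS
  have h2 : ∏ l ∈ t, (n * ‖ν l‖ / ρ) = (∏ l ∈ t, ‖ν l‖) * (n ^ t.card / ρ ^ t.card) := by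
    rw [← div_pow, ← Finset.prod_const, ← Finset.prod_mul_distrib]
    exact Finset.prod_congr rfl fun _ _ => by ring
  have h3 : (t.card.factorial : ℝ) ≤ (n : ℝ) ^ t.card := by
    exact_mod_cast (Nat.factorial_le_pow _).trans (Nat.pow_le_pow_left ht' _)
  rw [norm_mul, norm_prod, h2]
  simp only [norm_neg]
  calc (∏ l ∈ t, ‖ν l‖) * ‖∑ k ∈ s, W k * x k ^ t.card‖
      ≤ (∏ l ∈ t, ‖ν l‖) * (t.card.factorial * A / ρ ^ t.card) := by
        gcongr
        exact hW _
    _ ≤ (∏ l ∈ t, ‖ν l‖) * ((n : ℝ) ^ t.card * A / ρ ^ t.card) := by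
        gcongr
    _ = _ := by ring

/-- The places below `n` at which the real sequence `X` changes its sign. -/
noncomputable def signChanges (X : ℕ → ℝ) (n : ℕ) : Finset ℕ :=
  {k ∈ Finset.range n | ¬ (0 ≤ X k ↔ 0 ≤ X (k + 1))}

theorem half_sub_ne_zero (l c : ℕ) : (l : ℝ) + 1 / 2 - c ≠ 0 := by
  intro h
  have h1 : (2 * l + 1 : ℝ) = 2 * c := by linarith
  have h2 : 2 * l + 1 = 2 * c := by exact_mod_cast h1
  omega

theorem mul_half_sub_pos {l k : ℕ} (h : l ≠ k) :
    0 < ((l : ℝ) + 1 / 2 - k) * (l + 1 / 2 - (k + 1 : ℕ)) := by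
  push_cast
  rcases h.lt_or_gt with h | h
  · have : (l : ℝ) + 1 ≤ k := by exact_mod_cast h
    nlinarith
  · have : (k : ℝ) + 1 ≤ l := by exact_mod_cast h
    nlinarith

theorem sign_iff_of_mul_neg {x y t t' : ℝ} (ht : t * t' < 0) (h : ¬ (0 ≤ x ↔ 0 ≤ y)) :
    ((0 ≤ x ∧ 0 < t) ∨ (x < 0 ∧ t < 0)) ↔ ((0 ≤ y ∧ 0 < t') ∨ (y < 0 ∧ t' < 0)) := by
  rcases mul_neg_iff.1 ht with ⟨h1, h2⟩ | ⟨h1, h2⟩ <;> grind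

theorem sign_iff_of_mul_pos {x y t t' : ℝ} (ht : 0 < t * t') (h : 0 ≤ x ↔ 0 ≤ y) :
    ((0 ≤ x ∧ 0 < t) ∨ (x < 0 ∧ t < 0)) ↔ ((0 ≤ y ∧ 0 < t') ∨ (y < 0 ∧ t' < 0)) := by
  rcases mul_pos_iff.1 ht with ⟨h1, h2⟩ | ⟨h1, h2⟩ <;> grind

/-- A polynomial with simple zeros at the sign changes of `X` has the signs of `X`. -/
theorem mul_prod_signChanges_nonneg {X : ℕ → ℝ} {n c : ℕ} (hc : c ≤ n) (hX : 0 ≤ X c) {k : ℕ}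
    (hk : k ≤ n) :
    0 ≤ X k * ∏ l ∈ signChanges X n, (1 - ((l : ℝ) + 1 / 2 - c)⁻¹ * ((k : ℝ) - c)) := by
  classical
  set S := signChanges X n
  let T : ℕ → ℝ := fun k => ∏ l ∈ S, (1 - ((l : ℝ) + 1 / 2 - c)⁻¹ * ((k : ℝ) - c))
  have hfac : ∀ l k : ℕ, 1 - ((l : ℝ) + 1 / 2 - c)⁻¹ * ((k : ℝ) - c) =
      (l + 1 / 2 - k) / (l + 1 / 2 - c) := by
    intro l k
    rw [eq_div_iff (half_sub_ne_zero l c), sub_mul, mul_right_comm,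
      inv_mul_cancel₀ (half_sub_ne_zero l c)]
    ring
  have hTT : ∀ k, T k * T (k + 1) = ∏ l ∈ S,
      (((l : ℝ) + 1 / 2 - k) * (l + 1 / 2 - (k + 1 : ℕ)) / (l + 1 / 2 - c) ^ 2) := by
    intro k
    simp only [T]
    rw [← Finset.prod_mul_distrib]
    refine Finset.prod_congr rfl fun l _ => ?_
    rw [hfac, hfac, div_mul_div_comm, sq]
  have hpos : ∀ l k : ℕ, l ≠ k →
      0 < ((l : ℝ) + 1 / 2 - k) * (l + 1 / 2 - (k + 1 : ℕ)) / (l + 1 / 2 - c) ^ 2 :=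
    fun l k h => div_pos (mul_half_sub_pos h) (sq_pos_of_ne_zero (half_sub_ne_zero l c))
  have hout : ∀ k ∉ S, 0 < T k * T (k + 1) := by
    intro k hk
    rw [hTT]
    exact Finset.prod_pos fun l hl => hpos l k (fun h => hk (h ▸ hl))
  have hin : ∀ k ∈ S, T k * T (k + 1) < 0 := by
    intro k hk
    rw [hTT, ← Finset.mul_prod_erase _ _ hk]
    refine mul_neg_of_neg_of_pos (div_neg_of_neg_of_pos ?_ (sq_pos_of_ne_zero
      (half_sub_ne_zero k c))) (Finset.prod_pos fun l hl => hpos l k (Finset.ne_of_mem_erase hl))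
    push_cast
    nlinarith
  have hstep : ∀ k < n, ((0 ≤ X k ∧ 0 < T k) ∨ (X k < 0 ∧ T k < 0)) ↔
      ((0 ≤ X (k + 1) ∧ 0 < T (k + 1)) ∨ (X (k + 1) < 0 ∧ T (k + 1) < 0)) := by
    intro k hk
    by_cases hkS : k ∈ S
    · exact sign_iff_of_mul_neg (hin k hkS) (Finset.mem_filter.1 hkS).2
    · refine sign_iff_of_mul_pos (hout k hkS) ?_
      by_contra h
      exact hkS (Finset.mem_filter.2 ⟨Finset.mem_range.2 hk, h⟩)
  have hbase : (0 ≤ X c ∧ 0 < T c) ∨ (X c < 0 ∧ T c < 0) := Or.inl ⟨hX, by simp [T]⟩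
  have hall : ∀ k ≤ n, (0 ≤ X k ∧ 0 < T k) ∨ (X k < 0 ∧ T k < 0) := by
    intro k hk
    rcases le_total c k with hck | hkc
    · induction k, hck using Nat.le_induction with
      | base => exact hbase
      | succ k hck ih => exact (hstep k hk).1 (ih (by omega))
    · induction hkc using Nat.decreasingInduction with
      | self => exact hbase
      | of_succ k hkc ih => exact (hstep k (by omega)).2 (ih (by omega))
  rcases hall k hk with ⟨h1, h2⟩ | ⟨h1, h2⟩
  · exact mul_nonneg h1 h2.le
  · exact (mul_pos_of_neg_of_neg h1 h2).le

/-- Each term is at most $2\sqrt2(\sqrt{c+1}-\sqrt c)$, which telescopes. -/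
theorem sum_sqrt_inv_half_add_le (c : ℕ) :
    ∑ j ∈ Finset.range c, √(((j : ℝ) + 1 / 2)⁻¹) ≤ 2 * √2 * √c := by
  induction c with
  | zero => simp
  | succ c ih =>
    rw [Finset.sum_range_succ]
    have h1 : √(((c : ℝ) + 1 / 2)⁻¹) ≤ 2 * √2 * (√(c + 1) - √c) := by
      have h2 : (√((c : ℝ) + 1) - √c) * (√(c + 1) + √c) = 1 := by
        have e1 := Real.mul_self_sqrt (show (0 : ℝ) ≤ c + 1 by positivity)
        have e2 := Real.mul_self_sqrt (show (0 : ℝ) ≤ c by positivity)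
        nlinarith
      have h3 : √((c : ℝ) + 1) + √c ≤ 2 * √(c + 1) := by
        have : √(c : ℝ) ≤ √(c + 1) := Real.sqrt_le_sqrt (by linarith)
        linarith
      have h4 : √((c : ℝ) + 1) ≤ √2 * √(c + 1 / 2) := by
        rw [← Real.sqrt_mul (by norm_num)]
        exact Real.sqrt_le_sqrt (by linarith [show (0 : ℝ) ≤ c by positivity])
      have h5 : 0 < √((c : ℝ) + 1 / 2) := Real.sqrt_pos.2 (by positivity)
      have h6 : 0 ≤ √((c : ℝ) + 1) - √c := sub_nonneg.2 (Real.sqrt_le_sqrt (by linarith))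
      rw [Real.sqrt_inv, inv_le_iff_one_le_mul₀ h5]
      nlinarith [mul_le_mul_of_nonneg_left (h3.trans (mul_le_mul_of_nonneg_left h4 two_pos.le)) h6]
    push_cast
    linarith

theorem sum_sqrt_abs_inv_le (c : ℕ) :
    ∑ l ∈ Finset.range (2 * c), √|((l : ℝ) + 1 / 2 - c)⁻¹| ≤ 4 * √2 * √c := by
  have h := sum_sqrt_inv_half_add_le c
  rw [two_mul, Finset.sum_range_add, ← Finset.sum_range_reflect]
  have e1 : ∑ j ∈ Finset.range c, √|(((c - 1 - j : ℕ) : ℝ) + 1 / 2 - c)⁻¹| =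
      ∑ j ∈ Finset.range c, √(((j : ℝ) + 1 / 2)⁻¹) := by
    refine Finset.sum_congr rfl fun j hj => ?_
    have hj' : j + 1 ≤ c := Finset.mem_range.1 hj
    rw [show c - 1 - j = c - (j + 1) by omega, Nat.cast_sub hj', abs_inv]
    congr 2
    rw [abs_of_neg]
    · push_cast; ring
    · push_cast; linarith [show (0 : ℝ) ≤ j by positivity]
  have e2 : ∑ j ∈ Finset.range c, √|(((c + j : ℕ) : ℝ) + 1 / 2 - c)⁻¹| =
      ∑ j ∈ Finset.range c, √(((j : ℝ) + 1 / 2)⁻¹) := by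
    refine Finset.sum_congr rfl fun j _ => ?_
    rw [show ((c + j : ℕ) : ℝ) + 1 / 2 - c = j + 1 / 2 by push_cast; ring,
      abs_of_pos (by positivity)]
  rw [e1, e2]
  linarith

theorem abs_le_abs_sub_of_sign_change {x y : ℝ} (h : ¬ (0 ≤ x ↔ 0 ≤ y)) : |x| ≤ |y - x| := by
  by_cases hx : 0 ≤ x <;> by_cases hy : 0 ≤ y
  · exact absurd (by simp [hx, hy]) h
  · push Not at hy
    rw [abs_of_nonneg hx, abs_of_neg (by linarith)]
    linarith
  · push Not at hx
    rw [abs_of_neg hx, abs_of_pos (by linarith)]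
    linarith
  · exact absurd (by simp [hx, hy]) h

/-- Two different directions do not change the sign of a slowly varying sequence simultaneously. -/
theorem eq_of_sign_change {z z' : ℂ} {ε : ℝ} {J i i' : ℕ} (hz : z ≠ 0)
    (hzz : ‖z' - z‖ ≤ ε * ‖z‖) (hεJ : 10 * ε * J < 1) (hi : i < J) (hi' : i' < J)
    (h : ¬ (0 ≤ z.re - i / J * z.im ↔ 0 ≤ z'.re - i / J * z'.im))
    (h' : ¬ (0 ≤ z.re - i' / J * z.im ↔ 0 ≤ z'.re - i' / J * z'.im)) : i = i' := by
  by_contra hne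
  have hz0 : 0 < ‖z‖ := norm_pos_iff.2 hz
  have hε : 0 ≤ ε := by
    by_contra! hε
    nlinarith [norm_nonneg (z' - z)]
  have hJ1 : (1 : ℝ) ≤ J := by exact_mod_cast (by omega : 1 ≤ J)
  have hJ0 : (0 : ℝ) < J := by linarith
  have hre := Complex.abs_re_le_norm (z' - z)
  have him := Complex.abs_im_le_norm (z' - z)
  rw [Complex.sub_re] at hre
  rw [Complex.sub_im] at him
  -- At a sign change a form is no larger than its increment. Two such forms bound the imaginary
  -- part, then the real part; together they give $|z|\le10\varepsilon J|z|$, whence the constant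
  -- 10.
  have small : ∀ m : ℕ, m < J → ¬ (0 ≤ z.re - m / J * z.im ↔ 0 ≤ z'.re - m / J * z'.im) →
      |z.re - m / J * z.im| ≤ 2 * ε * ‖z‖ := by
    intro m hm hs
    have h1 := abs_le_abs_sub_of_sign_change hs
    have h2 : (m : ℝ) / J ≤ 1 := by
      rw [div_le_one hJ0]
      exact_mod_cast hm.le
    have h3 : (0 : ℝ) ≤ m / J := by positivity
    calc _ ≤ _ := h1
      _ = |(z'.re - z.re) - m / J * (z'.im - z.im)| := by ring_nf
      _ ≤ |z'.re - z.re| + |m / J * (z'.im - z.im)| := abs_sub _ _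
      _ ≤ ‖z' - z‖ + 1 * ‖z' - z‖ := by
          rw [abs_mul, abs_of_nonneg h3]
          gcongr
      _ ≤ _ := by linarith
  have b1 := small i hi h
  have b2 := small i' hi' h'
  have hd : (1 : ℝ) ≤ |(i : ℝ) - i'| := by
    have : (1 : ℤ) ≤ |(i : ℤ) - i'| := Int.one_le_abs (by omega)
    exact_mod_cast this
  have b3 : |z.im| ≤ 4 * ε * J * ‖z‖ := by
    have e : ((i : ℝ) - i') * z.im = J * ((z.re - i' / J * z.im) - (z.re - i / J * z.im)) := by
      field_simp
      ring
    calc |z.im| ≤ |(i : ℝ) - i'| * |z.im| := le_mul_of_one_le_left (abs_nonneg _) hd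
      _ = J * |(z.re - i' / J * z.im) - (z.re - i / J * z.im)| := by
          rw [← abs_mul, e, abs_mul, abs_of_pos hJ0]
      _ ≤ J * (2 * ε * ‖z‖ + 2 * ε * ‖z‖) := by
          gcongr
          exact (abs_sub _ _).trans (add_le_add b2 b1)
      _ = _ := by ring
  have b4 : |z.re| ≤ 2 * ε * ‖z‖ + |z.im| := by
    have h2 : (i : ℝ) / J ≤ 1 := by
      rw [div_le_one hJ0]
      exact_mod_cast hi.le
    have h3 : (0 : ℝ) ≤ i / J := by positivity
    calc |z.re| = |(z.re - i / J * z.im) + i / J * z.im| := by ring_nf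
      _ ≤ |z.re - i / J * z.im| + |i / J * z.im| := abs_add_le _ _
      _ ≤ _ := by
          rw [abs_mul, abs_of_nonneg h3]
          gcongr
          exact mul_le_of_le_one_left (abs_nonneg _) h2
  have b5 := Complex.norm_le_abs_re_add_abs_im z
  have b6 : ε * ‖z‖ ≤ ε * J * ‖z‖ := by
    gcongr
    exact le_mul_of_one_le_right hε hJ1
  nlinarith

/-- The square root is essential: with $x$ of size $c/|l+\frac12-c|$, the exponents sum over all
$l<2c$ to $O(c)$, while $1+x\le e^x$ would give $c\log c$. -/
theorem one_add_le_exp_two_sqrt {x : ℝ} (hx : 0 ≤ x) : 1 + x ≤ Real.exp (2 * √x) := by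
  have h1 := Real.add_one_le_exp (√x)
  have h2 := Real.sqrt_nonneg x
  have h3 := Real.mul_self_sqrt hx
  rw [two_mul, Real.exp_add]
  nlinarith

/-- Weight the Euler sum of order $2c$ by a polynomial equal to $1$ at $c$ and sharing the signs of
a real form of $a_k/a_c$. The middle term bounds the real part of the sum from below, and the moment
estimates bound its modulus from above. Choosing among $J$ forms makes the cost of the weight small.
-/
theorem EulerBound.centralBinom_le {a : ℕ → ℂ} {r ρ M ε : ℝ} {J : ℕ} (hρ : 0 < ρ) (hr : 0 < r)
    (h : EulerBound a r ρ M) (ha : ∀ k, a k ≠ 0) (haε : ∀ k, ‖a (k + 1) - a k‖ ≤ ε * ‖a k‖)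
    (hJ : 0 < J) (hεJ : 10 * ε * J < 1) (c : ℕ) :
    ‖a c‖ * c.centralBinom ≤
      2 * (M / r ^ (2 * c) * Real.exp (ρ * c)) * Real.exp (16 * c / (√ρ * J)) := by
  classical
  have hJ0 : (0 : ℝ) < J := by exact_mod_cast hJ
  have hac : 0 < ‖a c‖ := norm_pos_iff.2 (ha c)
  let β : ℕ → ℂ := fun k => a k / a c
  let X : ℕ → ℕ → ℝ := fun i k => (β k).re - i / J * (β k).im
  let ω : ℕ → ℝ := fun l => 2 * √((2 * c : ℕ) * |((l : ℝ) + 1 / 2 - c)⁻¹| / ρ)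
  have hω : ∑ l ∈ Finset.range (2 * c), ω l ≤ 16 * c / √ρ := by
    have e : ∀ l, ω l = 2 * (√2 * √c) / √ρ * √|((l : ℝ) + 1 / 2 - c)⁻¹| := by
      intro l
      simp only [ω]
      rw [Real.sqrt_div (by positivity), Real.sqrt_mul (by positivity), Nat.cast_mul,
        Nat.cast_ofNat, Real.sqrt_mul (by norm_num)]
      ring
    simp_rw [e]
    rw [← Finset.mul_sum]
    calc _ ≤ 2 * (√2 * √c) / √ρ * (4 * √2 * √c) := by
          gcongr
          exact sum_sqrt_abs_inv_le c
      _ = 8 * (√2 * √2) * (√c * √c) / √ρ := by ring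
      _ = _ := by
          rw [Real.mul_self_sqrt (by norm_num), Real.mul_self_sqrt (by positivity)]
          ring
  -- Pigeonhole: the $J$ forms have disjoint sets of sign changes, so one of them carries at most
  -- $1/J$ of the total cost.
  obtain ⟨i, hi, hSi⟩ : ∃ i ∈ Finset.range J, ∑ l ∈ signChanges (X i) (2 * c), ω l ≤
      16 * c / √ρ / J := by
    refine Finset.exists_le_of_sum_le ⟨0, Finset.mem_range.2 hJ⟩ ?_
    rw [Finset.sum_const, Finset.card_range, nsmul_eq_mul, mul_div_cancel₀ _ hJ0.ne']
    refine le_trans ?_ hω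
    have hdisj : (↑(Finset.range J) : Set ℕ).PairwiseDisjoint fun i => signChanges (X i) (2 * c) := by
      intro i hi i' hi' hne
      refine Finset.disjoint_left.2 fun k hk hk' => hne ?_
      have hβ : ‖β (k + 1) - β k‖ ≤ ε * ‖β k‖ := by
        simp only [β]
        rw [← sub_div, norm_div, norm_div, ← mul_div_assoc]
        gcongr
        exact haε k
      exact eq_of_sign_change (div_ne_zero (ha k) (ha c)) hβ hεJ
        (Finset.mem_range.1 hi) (Finset.mem_range.1 hi')
        (Finset.mem_filter.1 hk).2 (Finset.mem_filter.1 hk').2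
    rw [← Finset.sum_biUnion hdisj]
    refine Finset.sum_le_sum_of_subset_of_nonneg ?_ fun l _ _ => by positivity
    exact Finset.biUnion_subset.2 fun i _ => Finset.filter_subset _ _
  set S := signChanges (X i) (2 * c)
  let T : ℕ → ℝ := fun k => ∏ l ∈ S, (1 - ((l : ℝ) + 1 / 2 - c)⁻¹ * ((k : ℝ) - c))
  have hA : 0 ≤ M / r ^ (2 * c) * Real.exp (ρ * c) := by
    have := (norm_nonneg _).trans (h (2 * c) 0 (by simpa using hρ.le))
    positivity
  have hcard : S.card ≤ 2 * c := by
    exact (Finset.card_le_card (Finset.filter_subset _ _)).trans_eq (Finset.card_range _)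
  have up := norm_sum_mul_prod_le hρ hA (h.norm_moment_le hρ (2 * c) c) hcard
    (fun l => ((((l : ℝ) + 1 / 2 - c)⁻¹ : ℝ) : ℂ))
  have hprod : ∏ l ∈ S, (1 + (2 * c : ℕ) * ‖((((l : ℝ) + 1 / 2 - c)⁻¹ : ℝ) : ℂ)‖ / ρ) ≤
      Real.exp (16 * c / (√ρ * J)) := by
    calc _ ≤ ∏ l ∈ S, Real.exp (ω l) := by
          refine Finset.prod_le_prod (fun l _ => by positivity) fun l _ => ?_
          rw [Complex.norm_real, Real.norm_eq_abs]
          exact one_add_le_exp_two_sqrt (by positivity)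
      _ = Real.exp (∑ l ∈ S, ω l) := (Real.exp_sum _ _).symm
      _ ≤ _ := by
          rw [Real.exp_le_exp, ← div_div]
          exact hSi
  have hXc : X i c = 1 := by simp [X, β, ha c]
  have hTc : T c = 1 := by simp [T]
  have low : (c.centralBinom : ℝ) ≤
      ∑ k ∈ Finset.range (2 * c + 1), ((2 * c).choose k : ℝ) * (X i k * T k) := by
    have h1 := Finset.single_le_sum (f := fun k => ((2 * c).choose k : ℝ) * (X i k * T k))
      (s := Finset.range (2 * c + 1)) (fun k hk => mul_nonneg (Nat.cast_nonneg _)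
        (mul_prod_signChanges_nonneg (by omega) (by rw [hXc]; norm_num)
          (Nat.lt_succ_iff.1 (Finset.mem_range.1 hk)))) (Finset.mem_range.2 (by omega : c < 2 * c + 1))
    simpa [hXc, hTc, Nat.centralBinom_eq_two_mul_choose] using h1
  -- The form is $\operatorname{Re}((1+\tfrac iJ\sqrt{-1})\beta_k)$, and the weight `T k` is real.
  have hre : ∑ k ∈ Finset.range (2 * c + 1), ((2 * c).choose k : ℝ) * (X i k * T k) =
      ((1 + (i / J : ℝ) * Complex.I) / a c * ∑ k ∈ Finset.range (2 * c + 1),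
        ((2 * c).choose k * a k : ℂ) *
          ∏ l ∈ S, (1 - ((((l : ℝ) + 1 / 2 - c)⁻¹ : ℝ) : ℂ) * ((k : ℂ) - c))).re := by
    rw [Finset.mul_sum, Complex.re_sum]
    refine Finset.sum_congr rfl fun k _ => ?_
    have e1 : ∏ l ∈ S, (1 - ((((l : ℝ) + 1 / 2 - c)⁻¹ : ℝ) : ℂ) * ((k : ℂ) - c)) = (T k : ℂ) := by
      simp only [T]
      push_cast
      rfl
    have e2 : (1 + (i / J : ℝ) * Complex.I) / a c * (((2 * c).choose k * a k : ℂ) * (T k : ℂ)) =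
        (((2 * c).choose k * T k : ℝ) : ℂ) * ((1 + (i / J : ℝ) * Complex.I) * β k) := by
      simp only [β]
      push_cast
      ring
    rw [e1, e2, Complex.re_ofReal_mul]
    simp only [X, Complex.mul_re, Complex.add_re, Complex.one_re, Complex.ofReal_re, Complex.I_re,
      Complex.add_im, Complex.one_im, Complex.ofReal_im, Complex.I_im, Complex.mul_im]
    ring
  have hnorm : ‖(1 + (i / J : ℝ) * Complex.I : ℂ)‖ ≤ 2 := by
    have h2 : (i : ℝ) / J ≤ 1 := by
      rw [div_le_one hJ0]
      exact_mod_cast (Finset.mem_range.1 hi).le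
    have h3 : (0 : ℝ) ≤ i / J := by positivity
    refine (norm_add_le _ _).trans ?_
    rw [norm_one, norm_mul, Complex.norm_I, Complex.norm_real, Real.norm_of_nonneg h3]
    linarith
  rw [hre] at low
  have h7 := low.trans (Complex.re_le_norm _)
  rw [norm_mul, norm_div] at h7
  calc ‖a c‖ * c.centralBinom
      ≤ ‖a c‖ * (2 / ‖a c‖ * (M / r ^ (2 * c) * Real.exp (ρ * c) *
          Real.exp (16 * c / (√ρ * J)))) := by
        refine mul_le_mul_of_nonneg_left (h7.trans ?_) hac.le
        refine mul_le_mul (by gcongr) (up.trans ?_) (norm_nonneg _) (by positivity)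
        exact mul_le_mul_of_nonneg_left hprod hA
    _ = _ := by field_simp

/-! ### Fabry's ratio theorem -/

/-- **Fabry's ratio theorem**, in terms of Euler transforms. -/
theorem not_eulerBound_of_tendsto_ratio {a : ℕ → ℂ} (ha : ∀ᶠ n in atTop, a n ≠ 0)
    (hlim : Tendsto (fun n => a (n + 1) / a n) atTop (𝓝 1)) {r ρ M : ℝ} (hr : 1 / 2 < r)
    (hρ : 0 < ρ) : ¬ EulerBound a r ρ M := by
  intro hE
  have hr0 : 0 < r := lt_trans (by norm_num) hr
  -- $\sigma$ is the exponential gain per unit of $c$. The choices of $\rho'$, $J$ and $\varepsilon$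
  -- each lose at most $\sigma/4$, so growth at rate $\sigma/4$ survives against a bound linear in
  -- $c$.
  set σ := Real.log (4 * r ^ 2) with hσdef
  have hσ : 0 < σ := Real.log_pos (by nlinarith)
  obtain ⟨ρ', hρ'0, hρ'ρ, hρ'σ⟩ : ∃ ρ' > 0, ρ' ≤ ρ ∧ ρ' ≤ σ / 4 :=
    ⟨min ρ (σ / 4), lt_min hρ (by positivity), min_le_left _ _, min_le_right _ _⟩
  have hE' : EulerBound a r ρ' M := fun n u hu => hE n u (hu.trans hρ'ρ)
  obtain ⟨J, hJ⟩ := exists_nat_gt (64 / (√ρ' * σ))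
  have hsq : 0 < √ρ' := Real.sqrt_pos.2 hρ'0
  have hJ0 : (0 : ℝ) < J := lt_trans (by positivity) hJ
  have hJσ : 16 / (√ρ' * J) ≤ σ / 4 := by
    rw [div_lt_iff₀ (by positivity)] at hJ
    rw [div_le_div_iff₀ (by positivity) (by norm_num)]
    nlinarith
  obtain ⟨ε, hε0, hεJ, hεσ⟩ : ∃ ε > (0 : ℝ), 10 * ε * J < 1 ∧ Real.exp (-(σ / 4)) ≤ 1 - ε := by
    have h1 : 0 < 1 - Real.exp (-(σ / 4)) := by
      rw [sub_pos, Real.exp_lt_one_iff]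
      linarith
    refine ⟨min (1 / (20 * (J : ℝ))) (1 - Real.exp (-(σ / 4))), lt_min (by positivity) h1, ?_, ?_⟩
    · have : min (1 / (20 * (J : ℝ))) (1 - Real.exp (-(σ / 4))) ≤ 1 / (20 * J) := min_le_left _ _
      calc _ ≤ 10 * (1 / (20 * J)) * (J : ℝ) := by gcongr
        _ = 1 / 2 := by field_simp; norm_num
        _ < 1 := by norm_num
    · linarith [min_le_right (1 / (20 * (J : ℝ))) (1 - Real.exp (-(σ / 4)))]
  obtain ⟨k₀, hk₀⟩ := eventually_atTop.1
    (ha.and (hlim.eventually (closedBall_mem_nhds (1 : ℂ) hε0)))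
  obtain ⟨M', hM'⟩ := hE'.iterate_shift hr0 k₀
  let b : ℕ → ℂ := fun k => a (k + k₀)
  have hb : ∀ k, b k ≠ 0 := fun k => (hk₀ _ (Nat.le_add_left _ _)).1
  have hbε : ∀ k, ‖b (k + 1) - b k‖ ≤ ε * ‖b k‖ := by
    intro k
    have h1 := (hk₀ (k + k₀) (Nat.le_add_left _ _)).2
    rw [dist_eq_norm] at h1
    have e : b (k + 1) - b k = (a (k + k₀ + 1) / a (k + k₀) - 1) * b k := by
      have := hb k
      simp only [b] at this ⊢
      rw [sub_mul, div_mul_cancel₀ _ this, one_mul, add_right_comm]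
    rw [e, norm_mul]
    gcongr
  have hbc : ∀ c : ℕ, ‖b 0‖ * Real.exp (-(σ / 4)) ^ c ≤ ‖b c‖ := by
    intro c
    induction c with
    | zero => simp
    | succ c ih =>
      have h1 : (1 - ε) * ‖b c‖ ≤ ‖b (c + 1)‖ := by
        have := norm_sub_norm_le (b c) (b c - b (c + 1))
        rw [sub_sub_cancel, norm_sub_rev (b c)] at this
        linarith [hbε c]
      calc _ = Real.exp (-(σ / 4)) * (‖b 0‖ * Real.exp (-(σ / 4)) ^ c) := by ring
        _ ≤ (1 - ε) * ‖b c‖ := mul_le_mul hεσ ih (by positivity) ((Real.exp_pos _).le.trans hεσ)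
        _ ≤ _ := h1
  have hmain : ∀ c : ℕ, 0 < c → ‖b 0‖ * Real.exp (σ / 4) ^ c ≤ 4 * M' * c := by
    intro c hc
    have h1 := hM'.centralBinom_le hρ'0 hr0 hb hbε (by exact_mod_cast hJ0) hεJ c
    have h2 : (4 : ℝ) ^ c ≤ 2 * c * c.centralBinom := by
      exact_mod_cast Nat.four_pow_le_two_mul_self_mul_centralBinom c hc
    have hM'0 : 0 ≤ M' := by
      have := (norm_nonneg _).trans (hM' 0 0 (by simpa using hρ'0.le))
      simpa using this
    have h3 : Real.exp (16 * c / (√ρ' * J)) ≤ Real.exp (σ / 4) ^ c := by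
      rw [← Real.exp_nat_mul, Real.exp_le_exp]
      calc 16 * c / (√ρ' * J) = c * (16 / (√ρ' * J)) := by ring
        _ ≤ _ := by gcongr
    have h4 : Real.exp (ρ' * c) ≤ Real.exp (σ / 4) ^ c := by
      rw [← Real.exp_nat_mul, Real.exp_le_exp, mul_comm]
      gcongr
    have h5 : (4 * r ^ 2) = Real.exp (σ / 4) ^ 4 := by
      rw [← Real.exp_nat_mul, hσdef]
      rw [show ((4 : ℕ) : ℝ) * (Real.log (4 * r ^ 2) / 4) = Real.log (4 * r ^ 2) by push_cast; ring,
        Real.exp_log (by positivity)]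
    have h6 : Real.exp (-(σ / 4)) * Real.exp (σ / 4) = 1 := by rw [← Real.exp_add]; simp
    set E := Real.exp (σ / 4)
    have hE0 : 0 < E := Real.exp_pos _
    have h7 : (‖b 0‖ * Real.exp (-(σ / 4)) ^ c) * 4 ^ c ≤
        2 * c * (2 * (M' / r ^ (2 * c) * E ^ c) * E ^ c) := by
      calc _ ≤ ‖b c‖ * (2 * c * c.centralBinom) := by
            gcongr
            exact hbc c
        _ = 2 * c * (‖b c‖ * c.centralBinom) := by ring
        _ ≤ 2 * c * (2 * (M' / r ^ (2 * c) * Real.exp (ρ' * c)) * Real.exp (16 * c / (√ρ' * J))) := by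
            gcongr
        _ ≤ _ := by gcongr
    have h8 : (‖b 0‖ * Real.exp (-(σ / 4)) ^ c) * (4 * r ^ 2) ^ c ≤ 4 * M' * c * (E ^ c * E ^ c) := by
      have hrc : 0 < r ^ (2 * c) := by positivity
      calc _ = (‖b 0‖ * Real.exp (-(σ / 4)) ^ c) * 4 ^ c * r ^ (2 * c) := by
            rw [mul_pow, ← pow_mul]; ring
        _ ≤ 2 * c * (2 * (M' / r ^ (2 * c) * E ^ c) * E ^ c) * r ^ (2 * c) := by gcongr
        _ = _ := by field_simp; ring
    have h9 : (‖b 0‖ * Real.exp (-(σ / 4)) ^ c) * (4 * r ^ 2) ^ c =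
        ‖b 0‖ * E ^ c * (E ^ c * E ^ c) := by
      rw [h5]
      have : Real.exp (-(σ / 4)) ^ c * E ^ c = 1 := by rw [← mul_pow, h6, one_pow]
      calc _ = ‖b 0‖ * (Real.exp (-(σ / 4)) ^ c * E ^ c) * (E ^ c * (E ^ c * E ^ c)) := by ring
        _ = _ := by rw [this]; ring
    rw [h9] at h8
    exact le_of_mul_le_mul_right h8 (by positivity)
  have hE1 : 1 < Real.exp (σ / 4) := Real.one_lt_exp_iff.2 (by positivity)
  have hlim0 := (tendsto_pow_const_div_const_pow_of_one_lt 1 hE1).const_mul (4 * M')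
  rw [mul_zero] at hlim0
  have hb0 : 0 < ‖b 0‖ := norm_pos_iff.2 (hb 0)
  obtain ⟨c, hc1, hc2⟩ := ((hlim0.eventually_lt_const hb0).and (eventually_gt_atTop 0)).exists
  have h1 := hmain c hc2
  rw [pow_one, ← mul_div_assoc, div_lt_iff₀ (by positivity)] at hc1
  linarith

/-- The ratio test gives convergence in the disk; the substitution $z\mapsto\xi z$ moves the
boundary point to $1$. -/
theorem isSingularPoint_of_tendsto_ratio {F : PowerSeries ℂ} {ξ : ℂ} (hξ : ξ ≠ 0)
    (h0 : ∀ᶠ n in atTop, PowerSeries.coeff n F ≠ 0)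
    (hlim : Tendsto (fun n => PowerSeries.coeff (n + 1) F / PowerSeries.coeff n F) atTop (𝓝 ξ⁻¹)) :
    AnalyticInDisk F ‖ξ‖ ∧ IsSingularPoint F ξ := by
  have hdisk : AnalyticInDisk F ‖ξ‖ := by
    intro z hz
    rcases eq_or_ne z 0 with rfl | hz0
    · refine summable_of_ne_finset_zero (s := {0}) fun n hn => ?_
      rw [zero_pow (by simpa using hn), mul_zero]
    have hz' : ‖ξ⁻¹ * z‖ < 1 := by
      rw [norm_mul, norm_inv, inv_mul_lt_iff₀ (norm_pos_iff.2 hξ), mul_one]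
      simpa using hz
    refine summable_of_ratio_test_tendsto_lt_one hz' (h0.mono fun n hn =>
      mul_ne_zero hn (pow_ne_zero _ hz0)) ?_
    refine (hlim.mul_const z).norm.congr fun n => ?_
    rw [← norm_div]
    congr 1
    rw [pow_succ]
    field_simp
  refine ⟨hdisk, ?_⟩
  rintro ⟨h, hh, hF⟩
  let a : ℕ → ℂ := fun n => PowerSeries.coeff n F * ξ ^ n
  have hz : ∀ (z : ℂ) (n : ℕ), a n * z ^ n = PowerSeries.coeff n F * (ξ * z) ^ n := by
    intro z n
    simp only [a]
    ring
  have hmaps : ∀ z ∈ ball (0 : ℂ) 1, ξ * z ∈ ball (0 : ℂ) ‖ξ‖ := by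
    intro z hz
    rw [mem_ball_zero_iff] at hz ⊢
    rw [norm_mul]
    exact mul_lt_of_lt_one_right (norm_pos_iff.2 hξ) hz
  obtain ⟨r, ρ, M, hr, hρ, hE⟩ := exists_eulerBound (a := a) (h := fun z => h (ξ * z))
    (fun z hz1 => by
      simp_rw [hz]
      exact hdisk _ (hmaps z hz1))
    (AnalyticAt.fun_comp (f := fun z => ξ * z) (g := h) (by simpa using hh) (by fun_prop)) (by
      have ht : Tendsto (fun z => ξ * z) (𝓝[ball (0 : ℂ) 1] 1) (𝓝[ball (0 : ℂ) ‖ξ‖] ξ) := by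
        refine tendsto_nhdsWithin_iff.2 ⟨?_, eventually_nhdsWithin_of_forall hmaps⟩
        have : Tendsto (fun z => ξ * z) (𝓝 1) (𝓝 (ξ * 1)) := by
          exact (continuous_const.mul continuous_id).tendsto 1
        rw [mul_one] at this
        exact this.mono_left nhdsWithin_le_nhds
      filter_upwards [ht.eventually hF] with z hz1
      simp_rw [hz]
      exact hz1)
  refine not_eulerBound_of_tendsto_ratio (a := a) ?_ ?_ hr hρ hE
  · exact h0.mono fun n hn => mul_ne_zero hn (pow_ne_zero _ hξ)
  · have := hlim.mul_const ξ
    rw [inv_mul_cancel₀ hξ] at this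
    refine this.congr fun n => ?_
    simp only [a]
    rw [pow_succ]
    field_simp

/-! ### Dominant coordinates of nearly diagonal systems -/

/-- A forward contraction is iterated from a fixed time. A backward one is iterated from $s$ steps
in the future, where only the bound $u\le1$ is needed. -/
theorem tendsto_zero_of_le_mul_succ_add {u δ : ℕ → ℝ} {θ : ℝ} (h0 : ∀ t, 0 ≤ u t)
    (h1 : ∀ t, u t ≤ 1) (hθ0 : 0 ≤ θ) (hθ : θ < 1) (hδ : Tendsto δ atTop (𝓝 0))
    (hu : (∀ t, u (t + 1) ≤ θ * u t + δ t) ∨ ∀ t, u t ≤ θ * u (t + 1) + δ t) :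
    Tendsto u atTop (𝓝 0) := by
  rw [Metric.tendsto_atTop]
  intro η hη
  obtain ⟨T, hT⟩ := eventually_atTop.1 (hδ.eventually_lt_const
    (show 0 < (1 - θ) * (η / 2) from mul_pos (by linarith) (by linarith)))
  obtain ⟨s₀, hs₀⟩ := exists_pow_lt_of_lt_one (half_pos hη) hθ
  have key : ∀ t, T + s₀ ≤ t → u t < η := by
    intro t ht
    rcases hu with hu | hu
    · have h2 : ∀ s, u (T + s) ≤ η / 2 + θ ^ s := by
        intro s
        induction s with
        | zero => simpa using (h1 T).trans (by linarith)
        | succ s ih =>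
          have h3 := hu (T + s)
          have h4 := hT (T + s) (by omega)
          have h5 := mul_le_mul_of_nonneg_left ih hθ0
          rw [← add_assoc, pow_succ]
          linarith
      obtain ⟨s, rfl⟩ := Nat.exists_eq_add_of_le (show T ≤ t by omega)
      have h6 : θ ^ s ≤ θ ^ s₀ := pow_le_pow_of_le_one hθ0 hθ.le (by omega)
      linarith [h2 s]
    · have h2 : ∀ s t, T ≤ t → u t ≤ η / 2 + θ ^ s := by
        intro s
        induction s with
        | zero => intro t _; simpa using (h1 t).trans (by linarith)
        | succ s ih =>
          intro t ht
          have h3 := hu t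
          have h4 := hT t ht
          have h5 := mul_le_mul_of_nonneg_left (ih (t + 1) (by omega)) hθ0
          rw [pow_succ]
          linarith
      linarith [h2 s₀ t (by omega)]
  refine ⟨T + s₀, fun t ht => ?_⟩
  rw [dist_zero_right, Real.norm_of_nonneg (h0 t)]
  exact key t ht

/-- The quotients $u_t=|y_{t,j}/y_{t,i}|\le1$ satisfy $|\mu_i|u_{t+1}=|\mu_j|u_t$ up to
$2\varepsilon_t$: a contraction forward in time if $|\mu_j|<|\mu_i|$, backward if $|\mu_j|>|\mu_i|$.
-/
theorem tendsto_div_of_argmax {ι : Type*} {μ : ι → ℂ} {ε : ℕ → ℝ} {y : ℕ → ι → ℂ} (hμ : ∀ i j, ‖μ i‖ = ‖μ j‖ → i = j) {i : ι}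
    (hε : Tendsto ε atTop (𝓝 0)) (hy : ∀ t, y t i ≠ 0) (hi : ∀ t j, ‖y t j‖ ≤ ‖y t i‖)
    (hstep : ∀ t j, ‖y (t + 1) j - μ j * y t j‖ ≤ ε t * ‖y t i‖) :
    Tendsto (fun t => y (t + 1) i / y t i) atTop (𝓝 (μ i)) ∧
      ∀ j ≠ i, Tendsto (fun t => y t j / y t i) atTop (𝓝 0) := by
  have hpos : ∀ t, 0 < ‖y t i‖ := fun t => norm_pos_iff.2 (hy t)
  constructor
  · rw [tendsto_iff_norm_sub_tendsto_zero]
    refine squeeze_zero (fun _ => norm_nonneg _) (fun t => ?_) hε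
    rw [div_sub' (hy t), norm_div, div_le_iff₀ (hpos t), mul_comm (y t i)]
    exact hstep t i
  · intro j hj
    rw [tendsto_zero_iff_norm_tendsto_zero]
    let u : ℕ → ℝ := fun t => ‖y t j / y t i‖
    have hu : ∀ t, u t * ‖y t i‖ = ‖y t j‖ := fun t => by
      simp only [u]
      rw [norm_div, div_mul_cancel₀ _ (hpos t).ne']
    have hu0 : ∀ t, 0 ≤ u t := fun _ => norm_nonneg _
    have hu1 : ∀ t, u t ≤ 1 := fun t => by
      simp only [u]
      rw [norm_div]
      exact div_le_one_of_le₀ (hi t j) (norm_nonneg _)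
    have hbd : ∀ t, |‖μ i‖ * u (t + 1) - ‖μ j‖ * u t| ≤ 2 * ε t := by
      intro t
      have h1 : ∀ l, |‖y (t + 1) l‖ - ‖μ l‖ * ‖y t l‖| ≤ ε t * ‖y t i‖ := by
        intro l
        rw [← norm_mul]
        exact (abs_norm_sub_norm_le _ _).trans (hstep t l)
      have hi1 := h1 i
      have hj1 := h1 j
      rw [← hu, ← hu] at hj1
      have e : (‖μ i‖ * u (t + 1) - ‖μ j‖ * u t) * ‖y t i‖ =
          (u (t + 1) * ‖y (t + 1) i‖ - ‖μ j‖ * (u t * ‖y t i‖)) -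
            u (t + 1) * (‖y (t + 1) i‖ - ‖μ i‖ * ‖y t i‖) := by ring
      have h2 : |‖μ i‖ * u (t + 1) - ‖μ j‖ * u t| * ‖y t i‖ ≤ 2 * ε t * ‖y t i‖ := by
        rw [← abs_of_pos (hpos t), ← abs_mul, abs_of_pos (hpos t), e]
        refine (abs_sub _ _).trans ?_
        rw [abs_mul (u (t + 1)), abs_of_nonneg (hu0 _)]
        have h3 := mul_le_mul (hu1 (t + 1)) hi1 (abs_nonneg _) zero_le_one
        linarith
      exact le_of_mul_le_mul_right h2 (hpos t)
    rcases lt_or_gt_of_ne (fun h => hj (hμ j i h)) with hlt | hlt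
    · have ha : 0 < ‖μ i‖ := (norm_nonneg _).trans_lt hlt
      refine tendsto_zero_of_le_mul_succ_add (θ := ‖μ j‖ / ‖μ i‖) (δ := fun t => 2 * ε t / ‖μ i‖)
        hu0 hu1 (by positivity) ((div_lt_one ha).2 hlt) ?_ (Or.inl fun t => ?_)
      · simpa using (hε.const_mul 2).div_const ‖μ i‖
      · have := (abs_le.1 (hbd t)).2
        change u (t + 1) ≤ _ * u t + _
        rw [div_mul_eq_mul_div, ← add_div, le_div_iff₀ ha]
        linarith
    · have ha : 0 < ‖μ j‖ := (norm_nonneg _).trans_lt hlt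
      refine tendsto_zero_of_le_mul_succ_add (θ := ‖μ i‖ / ‖μ j‖) (δ := fun t => 2 * ε t / ‖μ j‖)
        hu0 hu1 (by positivity) ((div_lt_one ha).2 hlt) ?_ (Or.inr fun t => ?_)
      · simpa using (hε.const_mul 2).div_const ‖μ j‖
      · have := (abs_le.1 (hbd t)).1
        change u t ≤ _ * u (t + 1) + _
        rw [div_mul_eq_mul_div, ← add_div, le_div_iff₀ ha]
        linarith

theorem exists_norm_le_norm_apply {ι : Type*} [Fintype ι] [Nonempty ι] (y : ι → ℂ) :
    ∃ j, ‖y‖ ≤ ‖y j‖ := by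
  obtain ⟨j, hj⟩ := Finite.exists_max fun j => ‖y j‖
  exact ⟨j, (pi_norm_le_iff_of_nonneg (norm_nonneg _)).2 hj⟩

section Dominated

variable {E ι : Type*} [NormedAddCommGroup E] [NormedSpace ℂ E] [Fintype ι]
  {Y : ℕ → E →ₗ[ℂ] (ι → ℂ)} {μ : ι → ℂ} {ε : ℕ → ℝ}

/-- A largest coordinate $j$ keeps at least the factor $|\mu_j|-\varepsilon_t$, while coordinate $l$
reaches at most $|\mu_l|+\varepsilon_t$ times the norm. So dominance never passes to a smaller
$|\mu|$. -/
theorem norm_le_of_argmax_succ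
    (hY : ∀ t x, x ≠ 0 → Y t x ≠ 0)
    (hstep : ∀ t x j, ‖Y (t + 1) x j - μ j * Y t x j‖ ≤ ε t * ‖Y t x‖)
    (hgap : ∀ t j l, ‖μ j‖ < ‖μ l‖ → ‖μ j‖ + 2 * ε t < ‖μ l‖) {t : ℕ} {x : E} (hx : x ≠ 0)
    {j l : ι} (hj : ‖Y t x‖ ≤ ‖Y t x j‖) (hl : ‖Y (t + 1) x‖ ≤ ‖Y (t + 1) x l‖) :
    ‖μ j‖ ≤ ‖μ l‖ := by
  by_contra! hlt
  have hpos : 0 < ‖Y t x‖ := norm_pos_iff.2 (hY t x hx)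
  have h1 : ‖Y (t + 1) x l‖ ≤ ‖μ l‖ * ‖Y t x‖ + ε t * ‖Y t x‖ := by
    calc ‖Y (t + 1) x l‖ = ‖μ l * Y t x l + (Y (t + 1) x l - μ l * Y t x l)‖ := by ring_nf
      _ ≤ ‖μ l * Y t x l‖ + ‖Y (t + 1) x l - μ l * Y t x l‖ := norm_add_le _ _
      _ ≤ _ := by
          rw [norm_mul]
          gcongr
          · exact norm_le_pi_norm _ _
          · exact hstep t x l
  have h2 : ‖μ j‖ * ‖Y t x‖ - ε t * ‖Y t x‖ ≤ ‖Y (t + 1) x j‖ := by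
    have h3 := norm_sub_norm_le (μ j * Y t x j) (μ j * Y t x j - Y (t + 1) x j)
    rw [sub_sub_cancel, norm_sub_rev (μ j * Y t x j), norm_mul] at h3
    have h4 := mul_le_mul_of_nonneg_left hj (norm_nonneg (μ j))
    linarith [hstep t x j]
  have h5 := (norm_le_pi_norm (Y (t + 1) x) j).trans hl
  have h6 := mul_lt_mul_of_pos_right (hgap t l j hlt) hpos
  linarith

theorem norm_le_of_argmax
    (hY : ∀ t x, x ≠ 0 → Y t x ≠ 0)
    (hstep : ∀ t x j, ‖Y (t + 1) x j - μ j * Y t x j‖ ≤ ε t * ‖Y t x‖)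
    (hgap : ∀ t j l, ‖μ j‖ < ‖μ l‖ → ‖μ j‖ + 2 * ε t < ‖μ l‖) {t t' : ℕ} (htt : t < t') {x : E}
    (hx : x ≠ 0) {j l : ι} (hj : ‖Y t x‖ ≤ ‖Y t x j‖) (hl : ‖Y t' x‖ ≤ ‖Y t' x l‖) :
    ‖μ j‖ ≤ ‖μ l‖ := by
  induction t', htt using Nat.le_induction generalizing l with
  | base => exact norm_le_of_argmax_succ hY hstep hgap hx hj hl
  | succ t' htt ih =>
    have : Nonempty ι := ⟨j⟩
    obtain ⟨l', hl'⟩ := exists_norm_le_norm_apply (Y t' x)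
    exact (ih hl').trans (norm_le_of_argmax_succ hY hstep hgap hx hl' hl)

/-- Kill the coordinates with smaller $|\mu|$ at time $0$ and those with larger $|\mu|$ at time
$n+1$. These are one fewer conditions than the dimension, and monotonicity of the dominant modulus
leaves only $i$ in between. -/
theorem exists_argmax_upto [FiniteDimensional ℂ E] (hdim : Module.finrank ℂ E = Fintype.card ι)
    (hY : ∀ t x, x ≠ 0 → Y t x ≠ 0) (hμ : ∀ i j, ‖μ i‖ = ‖μ j‖ → i = j)
    (hstep : ∀ t x j, ‖Y (t + 1) x j - μ j * Y t x j‖ ≤ ε t * ‖Y t x‖)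
    (hgap : ∀ t j l, ‖μ j‖ < ‖μ l‖ → ‖μ j‖ + 2 * ε t < ‖μ l‖) (i : ι) (n : ℕ) :
    ∃ x : E, ‖x‖ = 1 ∧ ∀ t ≤ n, ∀ j, ‖Y t x j‖ ≤ ‖Y t x i‖ := by
  classical
  have : Nonempty ι := ⟨i⟩
  let Φ : E →ₗ[ℂ] ({l // l ≠ i} → ℂ) := LinearMap.pi fun l =>
    LinearMap.proj l.1 ∘ₗ (if ‖μ l‖ < ‖μ i‖ then Y 0 else Y (n + 1))
  have hker : LinearMap.ker Φ ≠ ⊥ := by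
    refine LinearMap.ker_ne_bot_of_finrank_lt ?_
    rw [Module.finrank_fintype_fun_eq_card, hdim]
    exact Fintype.card_subtype_lt (x := i) (by simp)
  obtain ⟨x, hxΦ, hx⟩ := (Submodule.ne_bot_iff _).1 hker
  have hx0 : ∀ l, ‖μ l‖ < ‖μ i‖ → Y 0 x l = 0 := by
    intro l hl
    have := congrFun (LinearMap.mem_ker.1 hxΦ) ⟨l, fun h => by simp [h] at hl⟩
    simpa [Φ, hl] using this
  have hxn : ∀ l, ‖μ i‖ < ‖μ l‖ → Y (n + 1) x l = 0 := by
    intro l hl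
    have := congrFun (LinearMap.mem_ker.1 hxΦ) ⟨l, fun h => by simp [h] at hl⟩
    simpa [Φ, hl.not_gt] using this
  have hne : ∀ t l, ‖Y t x‖ ≤ ‖Y t x l‖ → Y t x l ≠ 0 := by
    intro t l hl h0
    rw [h0, norm_zero] at hl
    exact hY t x hx (norm_le_zero_iff.1 hl)
  have hmax : ∀ t ≤ n, ‖Y t x‖ ≤ ‖Y t x i‖ := by
    intro t ht
    obtain ⟨j, hj⟩ := exists_norm_le_norm_apply (Y t x)
    obtain ⟨l, hl⟩ := exists_norm_le_norm_apply (Y (n + 1) x)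
    have h1 : ‖μ j‖ ≤ ‖μ i‖ :=
      (norm_le_of_argmax hY hstep hgap (Nat.lt_succ_of_le ht) hx hj hl).trans
        (not_lt.1 fun h => hne _ _ hl (hxn l h))
    have h2 : ‖μ i‖ ≤ ‖μ j‖ := by
      rcases Nat.eq_zero_or_pos t with rfl | ht0
      · exact not_lt.1 fun h => hne _ _ hj (hx0 j h)
      · obtain ⟨l', hl'⟩ := exists_norm_le_norm_apply (Y 0 x)
        exact (not_lt.1 fun h => hne _ _ hl' (hx0 l' h)).trans
          (norm_le_of_argmax hY hstep hgap ht0 hx hl' hj)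
    exact hμ j i (le_antisymm h1 h2) ▸ hj
  have hxn0 : ‖x‖ ≠ 0 := norm_ne_zero_iff.2 hx
  refine ⟨((‖x‖⁻¹ : ℝ) : ℂ) • x, ?_, fun t ht j => ?_⟩
  · rw [norm_smul, Complex.norm_real, norm_inv, norm_norm, inv_mul_cancel₀ hxn0]
  · rw [map_smul, Pi.smul_apply, Pi.smul_apply, norm_smul, norm_smul]
    gcongr
    exact (norm_le_pi_norm _ _).trans (hmax t ht)

/-- Compactness of the unit sphere: the solutions dominated by $i$ up to time $n$ form a decreasing
sequence of nonempty closed sets. -/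
theorem exists_argmax [FiniteDimensional ℂ E] (hdim : Module.finrank ℂ E = Fintype.card ι)
    (hY : ∀ t x, x ≠ 0 → Y t x ≠ 0) (hμ : ∀ i j, ‖μ i‖ = ‖μ j‖ → i = j)
    (hstep : ∀ t x j, ‖Y (t + 1) x j - μ j * Y t x j‖ ≤ ε t * ‖Y t x‖)
    (hgap : ∀ t j l, ‖μ j‖ < ‖μ l‖ → ‖μ j‖ + 2 * ε t < ‖μ l‖) (i : ι) :
    ∃ x : E, x ≠ 0 ∧ ∀ t j, ‖Y t x j‖ ≤ ‖Y t x i‖ := by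
  have hcont : ∀ t j, Continuous fun x => Y t x j := fun t j =>
    (continuous_apply j).comp (Y t).continuous_of_finiteDimensional
  let K : ℕ → Set E := fun n => sphere 0 1 ∩ {x | ∀ t ≤ n, ∀ j, ‖Y t x j‖ ≤ ‖Y t x i‖}
  have hK : ∀ n, IsClosed (K n) := by
    intro n
    refine isClosed_sphere.inter ?_
    simp only [Set.ofPred_forall]
    exact isClosed_iInter fun t => isClosed_iInter fun _ => isClosed_iInter fun j =>
      isClosed_le (hcont t j).norm (hcont t i).norm
  have : ProperSpace E := FiniteDimensional.proper ℂ E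
  obtain ⟨x, hx⟩ := IsCompact.nonempty_iInter_of_sequence_nonempty_isCompact_isClosed K
    (fun n x hx => ⟨hx.1, fun t ht => hx.2 t (by omega)⟩)
    (fun n => by
      obtain ⟨x, hx1, hx2⟩ := exists_argmax_upto hdim hY hμ hstep hgap i n
      exact ⟨x, by simpa using hx1, hx2⟩)
    ((isCompact_sphere 0 1).of_isClosed_subset (hK 0) Set.inter_subset_left) hK
  rw [Set.mem_iInter] at hx
  refine ⟨x, ?_, fun t => (hx t).2 t le_rfl⟩
  rintro rfl
  simpa using (hx 0).1

end Dominated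

/-! ### Perron's theorem for linear recurrences -/

/-- The shift `a ↦ (n ↦ a (n + 1))` of complex sequences. -/
noncomputable def seqShift : Module.End ℂ (ℕ → ℂ) :=
  LinearMap.funLeft ℂ ℂ Nat.succ

theorem seqShift_pow_apply (k : ℕ) (a : ℕ → ℂ) (t : ℕ) : (seqShift ^ k) a t = a (t + k) := by
  induction k generalizing t with
  | zero => rfl
  | succ k ih =>
    rw [pow_succ', Module.End.mul_apply]
    change (seqShift ^ k) a (t + 1) = _
    rw [ih]
    congr 1
    ring

theorem aeval_seqShift_apply {P : Polynomial ℂ} {n : ℕ} (hP : P.natDegree < n) (a : ℕ → ℂ)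
    (t : ℕ) : Polynomial.aeval seqShift P a t = ∑ k ∈ Finset.range n, P.coeff k * a (t + k) := by
  rw [Polynomial.aeval_eq_sum_range' hP, LinearMap.sum_apply, Finset.sum_apply]
  refine Finset.sum_congr rfl fun k _ => ?_
  rw [LinearMap.smul_apply, Pi.smul_apply, seqShift_pow_apply, smul_eq_mul]

/-- **Perron's theorem** on linear recurrences with convergent coefficients. The recurrence at `t`
has the monic characteristic polynomial `χ t`, the limit polynomial has the zeros `μ i`, and the
space `E` represents all the solutions. -/
theorem exists_solution_tendsto_ratio {E ι : Type*} [NormedAddCommGroup E] [NormedSpace ℂ E]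
    [FiniteDimensional ℂ E] [Fintype ι] (hdim : Module.finrank ℂ E = Fintype.card ι)
    {μ : ι → ℂ} (hμ : ∀ i j, ‖μ i‖ = ‖μ j‖ → i = j) (A : E →ₗ[ℂ] (ℕ → ℂ))
    (hA : ∀ x t₀, (∀ t, t₀ ≤ t → A x t = 0) → x = 0) {χ : ℕ → Polynomial ℂ}
    (hχdeg : ∀ t, (χ t).natDegree ≤ Fintype.card ι)
    (hχmonic : ∀ᶠ t in atTop, (χ t).coeff (Fintype.card ι) = 1)
    (hχ : ∀ k, Tendsto (fun t => (χ t).coeff k) atTop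
      (𝓝 ((Lagrange.nodal Finset.univ μ).coeff k)))
    (hrec : ∀ᶠ t in atTop, ∀ x, Polynomial.aeval seqShift (χ t) (A x) t = 0) (i : ι) :
    ∃ x : E, (∀ᶠ n in atTop, A x n ≠ 0) ∧
      Tendsto (fun n => A x (n + 1) / A x n) atTop (𝓝 (μ i)) := by
  classical
  set N := Fintype.card ι
  have hinj : Function.Injective μ := fun i j h => hμ i j (by rw [h])
  let B : ι → Polynomial ℂ := Lagrange.basis Finset.univ μ
  let w : ι → ℂ := Lagrange.nodalWeight Finset.univ μ
  let D : Polynomial ℂ := Lagrange.nodal Finset.univ μ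
  have hDdeg : D.natDegree = N := Lagrange.natDegree_nodal
  have hDN : D.coeff N = 1 := by
    have := (Lagrange.nodal_monic (s := Finset.univ) (v := μ)).coeff_natDegree
    rwa [Lagrange.natDegree_nodal] at this
  have hBD : ∀ j, (Polynomial.X - Polynomial.C (μ j)) * B j = Polynomial.C (w j) * D := by
    intro j
    have h1 := Lagrange.basis_eq_prod_sub_inv_mul_nodal_div (v := μ) (Finset.mem_univ j)
    have h2 : (Polynomial.X - Polynomial.C (μ j)) * (D / (Polynomial.X - Polynomial.C (μ j))) = D :=
      EuclideanDomain.mul_div_cancel' (Polynomial.X_sub_C_ne_zero _)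
        (Lagrange.X_sub_C_dvd_nodal μ (Finset.mem_univ j))
    simp only [B, h1]
    rw [mul_left_comm, h2]
  have hpow : ∀ k < N, (Polynomial.X : Polynomial ℂ) ^ k = ∑ j, Polynomial.C (μ j ^ k) * B j := by
    intro k hk
    have := Lagrange.eq_interpolate (s := Finset.univ) (v := μ) (f := Polynomial.X ^ k)
      hinj.injOn (by rw [Polynomial.degree_X_pow]; exact_mod_cast hk)
    rw [Lagrange.interpolate_apply] at this
    simpa [B] using this
  -- The Lagrange basis polynomials in the shift give coordinates in which the limit recurrence is
  -- diagonal, since $(X-\mu_j)B_j$ is a multiple of $D$.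
  let Y : ℕ → E →ₗ[ℂ] (ι → ℂ) := fun t => LinearMap.pi fun j =>
    LinearMap.proj t ∘ₗ Polynomial.aeval seqShift (B j) ∘ₗ A
  have hYapp : ∀ t x j, Y t x j = Polynomial.aeval seqShift (B j) (A x) t := fun _ _ _ => rfl
  have hval : ∀ t x, ∀ k < N, A x (t + k) = ∑ j, μ j ^ k * Y t x j := by
    intro t x k hk
    rw [← seqShift_pow_apply k (A x) t, ← Polynomial.aeval_X_pow (R := ℂ), hpow k hk]
    simp only [map_sum, map_mul, Polynomial.aeval_C, LinearMap.sum_apply, Finset.sum_apply]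
    refine Finset.sum_congr rfl fun j _ => ?_
    rw [hYapp, Module.End.mul_apply, Module.algebraMap_end_apply, Pi.smul_apply, smul_eq_mul]
  let c : ℕ → ℝ := fun k => ∑ j, ‖μ j‖ ^ k
  have hvalbd : ∀ t x, ∀ k < N, ‖A x (t + k)‖ ≤ c k * ‖Y t x‖ := by
    intro t x k hk
    rw [hval t x k hk]
    refine (norm_sum_le _ _).trans ?_
    simp only [c]
    rw [Finset.sum_mul]
    refine Finset.sum_le_sum fun j _ => ?_
    rw [norm_mul, norm_pow]
    gcongr
    exact norm_le_pi_norm _ _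
  let ε : ℕ → ℝ := fun t => (∑ j, ‖w j‖) * ∑ k ∈ Finset.range N, ‖(D - χ t).coeff k‖ * c k
  have hε : Tendsto ε atTop (𝓝 0) := by
    have h1 : ∀ k, Tendsto (fun t => ‖(D - χ t).coeff k‖ * c k) atTop (𝓝 0) := by
      intro k
      have := (((hχ k).const_sub (D.coeff k)).norm).mul_const (c k)
      simpa [D] using this
    have h2 := (tendsto_finsetSum (Finset.range N) fun k _ => h1 k).const_mul (∑ j, ‖w j‖)
    rw [Finset.sum_const_zero, mul_zero] at h2
    exact h2
  have hstep0 : ∀ᶠ t in atTop, ∀ x j, ‖Y (t + 1) x j - μ j * Y t x j‖ ≤ ε t * ‖Y t x‖ := by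
    filter_upwards [hχmonic, hrec] with t ht1 ht2 x j
    -- As $\chi_t$ annihilates the sequence at $t$, $D$ may be replaced by $D-\chi_t$, which has
    -- small coefficients and, both being monic, degree below $N$.
    have e1 : Y (t + 1) x j - μ j * Y t x j =
        w j * Polynomial.aeval seqShift (D - χ t) (A x) t := by
      have h1 := congrArg (fun P => Polynomial.aeval seqShift P (A x) t) (hBD j)
      simp only [map_mul, map_sub, Polynomial.aeval_X, Polynomial.aeval_C, Module.End.mul_apply,
        LinearMap.sub_apply, Module.algebraMap_end_apply, Pi.sub_apply, Pi.smul_apply,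
        smul_eq_mul] at h1 ⊢
      rw [ht2 x, sub_zero, ← h1]
      rfl
    have e2 : Polynomial.aeval seqShift (D - χ t) (A x) t =
        ∑ k ∈ Finset.range N, (D - χ t).coeff k * A x (t + k) := by
      rw [aeval_seqShift_apply (n := N + 1), Finset.sum_range_succ, Polynomial.coeff_sub, hDN, ht1,
        sub_self, zero_mul, add_zero]
      refine Nat.lt_succ_of_le ((Polynomial.natDegree_sub_le _ _).trans (max_le hDdeg.le (hχdeg t)))
    rw [e1, e2, norm_mul]
    simp only [ε]
    rw [mul_assoc]
    gcongr
    · exact Finset.single_le_sum (f := fun j => ‖w j‖) (fun _ _ => norm_nonneg _) (Finset.mem_univ j)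
    · rw [Finset.sum_mul]
      refine (norm_sum_le _ _).trans (Finset.sum_le_sum fun k hk => ?_)
      rw [norm_mul, mul_assoc]
      gcongr
      exact hvalbd t x k (Finset.mem_range.1 hk)
  have hgap0 : ∀ᶠ t in atTop, ∀ j l, ‖μ j‖ < ‖μ l‖ → ‖μ j‖ + 2 * ε t < ‖μ l‖ := by
    refine eventually_all.2 fun j => eventually_all.2 fun l => ?_
    by_cases h : ‖μ j‖ < ‖μ l‖
    · have := (hε.const_mul 2).const_add ‖μ j‖
      rw [mul_zero, add_zero] at this
      exact (this.eventually_lt_const h).mono fun _ ht _ => ht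
    · exact Eventually.of_forall fun _ h' => absurd h' h
  obtain ⟨T, hT⟩ := eventually_atTop.1 (((hχmonic.and hrec).and hstep0).and hgap0)
  -- Zero coordinates at $t$ mean $N$ consecutive zero terms, which the recurrence propagates to all
  -- later terms.
  have hY0 : ∀ t, T ≤ t → ∀ x, x ≠ 0 → Y t x ≠ 0 := by
    intro t ht x hx hYx
    refine hx (hA x t fun s hs => ?_)
    induction s using Nat.strong_induction_on with
    | _ s ih =>
      rcases lt_or_ge s (t + N) with hlt | hge
      · obtain ⟨k, rfl⟩ := Nat.exists_eq_add_of_le hs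
        rw [hval t x k (by omega), hYx]
        simp
      · obtain ⟨s', rfl⟩ := Nat.exists_eq_add_of_le' ((Nat.le_add_left N t).trans hge)
        have hs' := hT s' (by omega)
        have h1 := hs'.1.1.2 x
        rw [aeval_seqShift_apply (n := N + 1) (Nat.lt_succ_of_le (hχdeg s')),
          Finset.sum_range_succ, hs'.1.1.1, one_mul, Finset.sum_eq_zero, zero_add] at h1
        · exact h1
        · intro k hk
          have hk' := Finset.mem_range.1 hk
          rw [ih (s' + k) (by omega) (by omega), mul_zero]
  obtain ⟨x, hx, hxi⟩ := exists_argmax (Y := fun t => Y (T + t)) (ε := fun t => ε (T + t)) hdim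
    (fun t => hY0 _ (by omega)) hμ (fun t => (hT (T + t) (by omega)).1.2)
    (fun t => (hT (T + t) (by omega)).2) i
  have : Nonempty ι := ⟨i⟩
  have hnorm : ∀ t, ‖Y (T + t) x‖ = ‖Y (T + t) x i‖ := fun t =>
    le_antisymm ((pi_norm_le_iff_of_nonneg (norm_nonneg _)).2 (hxi t)) (norm_le_pi_norm _ _)
  have hyi : ∀ t, Y (T + t) x i ≠ 0 := fun t => by
    rw [← norm_ne_zero_iff, ← hnorm]
    exact norm_ne_zero_iff.2 (hY0 _ (by omega) x hx)
  have hε' : Tendsto (fun t => ε (T + t)) atTop (𝓝 0) := by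
    simpa only [add_comm T] using (tendsto_add_atTop_iff_nat T).2 hε
  obtain ⟨hr1, hr2⟩ := tendsto_div_of_argmax (y := fun t => Y (T + t) x) hμ hε' hyi hxi
    (fun t j => by rw [← hnorm]; exact (hT (T + t) (by omega)).1.2 x j)
  have hNpos : 0 < N := Fintype.card_pos
  -- The term at $t$ is the sum of all coordinates, of which only the $i$-th counts in the limit.
  have hsum : Tendsto (fun t => A x (T + t) / Y (T + t) x i) atTop (𝓝 1) := by
    have h1 : ∀ j, Tendsto (fun t => Y (T + t) x j / Y (T + t) x i) atTop
        (𝓝 (if j = i then 1 else 0)) := by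
      intro j
      split_ifs with hji
      · subst hji
        exact tendsto_const_nhds.congr fun t => (div_self (hyi t)).symm
      · exact hr2 j hji
    have h2 := tendsto_finsetSum Finset.univ fun j _ => h1 j
    rw [Finset.sum_ite_eq' Finset.univ i, if_pos (Finset.mem_univ i)] at h2
    refine h2.congr fun t => ?_
    have h3 := hval (T + t) x 0 hNpos
    rw [add_zero] at h3
    rw [h3, Finset.sum_div]
    simp
  have hne : ∀ᶠ t in atTop, A x (T + t) ≠ 0 := by
    filter_upwards [hsum.eventually_ne one_ne_zero] with t ht h0
    exact ht (by rw [h0, zero_div])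
  refine ⟨x, ?_, ?_⟩
  · rw [← map_add_atTop_eq_nat T, eventually_map]
    simpa only [add_comm T] using hne
  · rw [← tendsto_add_atTop_iff_nat T]
    have h1 := ((tendsto_add_atTop_iff_nat 1).2 hsum).mul (hr1.div hsum one_ne_zero)
    rw [div_one, one_mul] at h1
    refine h1.congr fun t => ?_
    have h2 := hyi t
    have h3 := hyi (t + 1)
    simp only [Pi.div_apply, ← add_assoc] at h3 ⊢
    rw [add_comm t T, div_div_div_cancel_right₀ h2, div_mul_div_cancel₀ h3]

/-! ### Recurrences from Hermite–Padé denominators -/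

section Coefficients

variable {d : ℕ} {m : Fin d → ℕ}

/-- The polynomials with prescribed coefficients `x ⟨k, s⟩`, `s < m k`. -/
noncomputable def polyOfCoeffs (x : (Σ k, Fin (m k)) → ℂ) (k : Fin d) : Polynomial ℂ :=
  ∑ s : Fin (m k), Polynomial.monomial s (x ⟨k, s⟩)

theorem degreesBelow_polyOfCoeffs (x : (Σ k, Fin (m k)) → ℂ) : DegreesBelow m (polyOfCoeffs x) := by
  intro k
  refine (Polynomial.degree_sum_le _ _).trans_lt ((Finset.sup_lt_iff (WithBot.bot_lt_coe _)).2 ?_)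
  intro s _
  exact (Polynomial.degree_monomial_le _ _).trans_lt (by exact_mod_cast s.2)

theorem coeff_polyOfCoeffs (x : (Σ k, Fin (m k)) → ℂ) (k : Fin d) (s : Fin (m k)) :
    (polyOfCoeffs x k).coeff s = x ⟨k, s⟩ := by
  simp [polyOfCoeffs, Polynomial.coeff_monomial, Fin.val_inj]

/-- The coefficient sequences of all the combinations `∑ k, p k * f k` with `deg (p k) < m k`. -/
noncomputable def combinationCoeffs (f : Fin d → PowerSeries ℂ) (m : Fin d → ℕ) :
    ((Σ k, Fin (m k)) → ℂ) →ₗ[ℂ] (ℕ → ℂ) :=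
  Fintype.linearCombination ℂ fun σ n => PowerSeries.coeff n (PowerSeries.X ^ (σ.2 : ℕ) * f σ.1)

theorem combinationCoeffs_apply (f : Fin d → PowerSeries ℂ) (x : (Σ k, Fin (m k)) → ℂ) (n : ℕ) :
    combinationCoeffs f m x n = PowerSeries.coeff n (combination f (polyOfCoeffs x)) := by
  have h : combination f (polyOfCoeffs x) =
      ∑ σ : (Σ k, Fin (m k)), x σ • (PowerSeries.X ^ (σ.2 : ℕ) * f σ.1) := by
    rw [combination, Fintype.sum_sigma]
    refine Finset.sum_congr rfl fun k _ => ?_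
    have : ((polyOfCoeffs x k : Polynomial ℂ) : PowerSeries ℂ) =
        ∑ s : Fin (m k), x ⟨k, s⟩ • (PowerSeries.X : PowerSeries ℂ) ^ (s : ℕ) := by
      rw [polyOfCoeffs, ← Polynomial.coeToPowerSeries.ringHom_apply, map_sum]
      refine Finset.sum_congr rfl fun s _ => ?_
      rw [Polynomial.coeToPowerSeries.ringHom_apply, Polynomial.coe_monomial,
        PowerSeries.X_pow_eq, ← map_smul, smul_eq_mul, mul_one]
    rw [this, Finset.sum_mul]
    exact Finset.sum_congr rfl fun s _ => smul_mul_assoc _ _ _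
  rw [h, combinationCoeffs, Fintype.linearCombination_apply, Finset.sum_apply, map_sum]
  exact Finset.sum_congr rfl fun σ _ => by simp

theorem eq_zero_of_combinationCoeffs_eq_zero {f : Fin d → PowerSeries ℂ}
    (hf : PolynomiallyIndependent f m) {x : (Σ k, Fin (m k)) → ℂ} {t₀ : ℕ}
    (h : ∀ t, t₀ ≤ t → combinationCoeffs f m x t = 0) : x = 0 := by
  by_contra hx
  obtain ⟨⟨k, s⟩, hks⟩ := Function.ne_iff.1 hx
  refine hf ⟨polyOfCoeffs x, ⟨k, fun h0 => hks ?_⟩, degreesBelow_polyOfCoeffs x,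
    PowerSeries.trunc t₀ (combination f (polyOfCoeffs x)), ?_⟩
  · rw [← coeff_polyOfCoeffs x, h0]
    simp
  · ext n
    rw [Polynomial.coeff_coe, PowerSeries.coeff_trunc]
    split_ifs with hn
    · rfl
    · rw [← combinationCoeffs_apply, h n (not_lt.1 hn)]

end Coefficients

theorem aeval_seqShift_reflect {q : Polynomial ℂ} {N : ℕ} (hq : q.natDegree ≤ N)
    (F : PowerSeries ℂ) (t : ℕ) :
    Polynomial.aeval seqShift (q.reflect N) (fun n => PowerSeries.coeff n F) t =
      PowerSeries.coeff (t + N) ((q : PowerSeries ℂ) * F) := by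
  have hdeg : (q.reflect N).natDegree < N + 1 :=
    Nat.lt_succ_of_le (Polynomial.natDegree_reflect_le.trans (max_le le_rfl hq))
  rw [aeval_seqShift_apply hdeg, PowerSeries.coeff_mul,
    Finset.Nat.sum_antidiagonal_eq_sum_range_succ_mk,
    ← Finset.sum_subset (Finset.range_mono (show N + 1 ≤ (t + N).succ by omega)),
    ← Finset.sum_range_reflect]
  · refine Finset.sum_congr rfl fun k hk => ?_
    have hk' : k ≤ N := Nat.lt_succ_iff.1 (Finset.mem_range.1 hk)
    rw [Polynomial.coeff_reflect, Polynomial.revAt_le (by omega), Polynomial.coeff_coe]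
    congr 2
    · omega
    · congr 1
      omega
  · intro k _ hk
    have hk' : N < k := by
      rw [Finset.mem_range] at hk
      omega
    rw [Polynomial.coeff_coe, Polynomial.coeff_eq_zero_of_natDegree_lt (hq.trans_lt hk'), zero_mul]

/-- The index $n-s$ exceeds $n-m_k\ge\deg p_k$ but is still at most $n$, so both $p_k$ and the
remainder contribute nothing. -/
theorem IsDenominator.coeff_mul_eq_zero {d : ℕ} {f : Fin d → PowerSeries ℂ} {m : Fin d → ℕ}
    {n : ℕ} {q : Polynomial ℂ} (hq : IsDenominator f m n q) {k : Fin d} (hk : m k ≤ n) {s : ℕ}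
    (hs : s < m k) :
    PowerSeries.coeff n ((q : PowerSeries ℂ) * (PowerSeries.X ^ s * f k)) = 0 := by
  obtain ⟨-, -, ⟨p, hp⟩, -⟩ := hq
  obtain ⟨hpdeg, hpdvd⟩ := hp k
  have h1 := PowerSeries.X_pow_dvd_iff.1 hpdvd (n - s) (by omega)
  rw [map_sub, Polynomial.coeff_coe, Polynomial.coeff_eq_zero_of_natDegree_lt (by omega),
    sub_zero] at h1
  rw [mul_left_comm, ← h1]
  conv_lhs => rw [show n = (n - s) + s by omega]
  rw [PowerSeries.coeff_X_pow_mul]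

/-- Both sides are monic of degree $N$, the left one because $Q(0)=1$, and both vanish at the $N$
distinct points $1/z_i$. -/
theorem reflect_eq_nodal {Q : Polynomial ℂ} {N : ℕ} (hN : Q.natDegree = N) (hQ0 : Q.coeff 0 = 1)
    {ι : Type*} [Fintype ι] (hι : Fintype.card ι = N) {z : ι → ℂ} (hz : Function.Injective z)
    (hroot : ∀ i, Q.IsRoot (z i)) :
    Q.reflect N = Lagrange.nodal Finset.univ fun i => (z i)⁻¹ := by
  have hz0 : ∀ i, z i ≠ 0 := by
    intro i h
    have := hroot i
    rw [h, Polynomial.IsRoot, ← Polynomial.coeff_zero_eq_eval_zero, hQ0] at this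
    exact one_ne_zero this
  have hD : (Lagrange.nodal Finset.univ fun i => (z i)⁻¹).natDegree = N := by
    rw [Lagrange.natDegree_nodal, Finset.card_univ, hι]
  have hR : (Q.reflect N).natDegree ≤ N :=
    Polynomial.natDegree_reflect_le.trans (max_le le_rfl hN.le)
  refine Polynomial.eq_of_degree_sub_lt_of_eval_index_eq (s := Finset.univ)
    (v := fun i => (z i)⁻¹) (fun i _ j _ h => hz (inv_injective h)) ?_ fun i _ => ?_
  · rw [Finset.card_univ, hι, Polynomial.degree_lt_iff_coeff_zero]
    intro k hk
    rw [Polynomial.coeff_sub]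
    rcases hk.eq_or_lt with rfl | hlt
    · have h1 := (Lagrange.nodal_monic (s := Finset.univ) (v := fun i => (z i)⁻¹)).coeff_natDegree
      rw [hD] at h1
      rw [h1, Polynomial.coeff_reflect, Polynomial.revAt_le le_rfl, Nat.sub_self, hQ0, sub_self]
    · rw [Polynomial.coeff_eq_zero_of_natDegree_lt (hR.trans_lt hlt),
        Polynomial.coeff_eq_zero_of_natDegree_lt (hD.trans_lt hlt), sub_zero]
  · rw [Lagrange.eval_nodal_at_node (v := fun i => (z i)⁻¹) (Finset.mem_univ i)]
    have := invertibleOfNonzero (hz0 i)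
    have h := (Polynomial.eval₂_reflect_eq_zero_iff (RingHom.id ℂ) (z i) N Q hN.le).2 (hroot i)
    rwa [invOf_eq_inv] at h

end HermitePade

theorem corollary2 {d : ℕ} (f : Fin d → PowerSeries ℂ) (m : Fin d → ℕ) (hm : m ≠ 0)
    (q : ℕ → Polynomial ℂ) (Q : Polynomial ℂ)
    (hq : ∀ n, (∀ k, m k ≤ n) → HermitePade.IsDenominator f m n (q n))
    (hlim : ∀ i, Filter.Tendsto (fun n => (q n).coeff i) Filter.atTop (nhds (Q.coeff i)))
    (hdeg : Q.natDegree = ∑ k, m k) (hQ0 : Q.eval 0 = 1)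
    (hf : HermitePade.PolynomiallyIndependent f m)
    (hdist : (Q.roots.map fun z => ‖z‖).Nodup) :
    ∀ ζ : ℂ, Q.IsRoot ζ → HermitePade.IsSystemSingularity f m ζ := by
  classical
  intro ζ hζ
  set N := ∑ k, m k
  have hQc : Q.coeff 0 = 1 := by rw [Polynomial.coeff_zero_eq_eval_zero, hQ0]
  have hQne : Q ≠ 0 := by
    rintro rfl
    simp at hQ0
  let ι := {z // z ∈ Q.roots.toFinset}
  have hroot : ∀ z : ι, Q.IsRoot z := fun z =>
    Polynomial.isRoot_of_mem_roots (Multiset.mem_toFinset.1 z.2)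
  have hcard : Fintype.card ι = N := by
    rw [Fintype.card_coe, Multiset.toFinset_card_of_nodup (Multiset.Nodup.of_map _ hdist), ← hdeg]
    exact (IsAlgClosed.splits Q).natDegree_eq_card_roots.symm
  have hμ : ∀ i j : ι, ‖(i : ℂ)⁻¹‖ = ‖(j : ℂ)⁻¹‖ → i = j := by
    intro i j hij
    rw [norm_inv, norm_inv, inv_inj] at hij
    exact Subtype.ext (Multiset.inj_on_of_nodup_map hdist _ (Multiset.mem_toFinset.1 i.2) _
      (Multiset.mem_toFinset.1 j.2) hij)
  have hmN : ∀ k t, m k ≤ t + N := fun k t =>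
    (Finset.single_le_sum (fun _ _ => Nat.zero_le _) (Finset.mem_univ k)).trans (Nat.le_add_left _ _)
  have hden : ∀ t, HermitePade.IsDenominator f m (t + N) (q (t + N)) := fun t =>
    hq _ fun k => hmN k t
  have hlimN : ∀ i, Filter.Tendsto (fun t => (q (t + N)).coeff i) Filter.atTop
      (nhds (Q.coeff i)) := fun i => (Filter.tendsto_add_atTop_iff_nat N).2 (hlim i)
  have hnodal := HermitePade.reflect_eq_nodal hdeg hQc hcard Subtype.val_injective hroot
  obtain ⟨x, hx1, hx2⟩ := HermitePade.exists_solution_tendsto_ratio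
    (E := (Σ k, Fin (m k)) → ℂ) (ι := ι) (μ := fun z => (z : ℂ)⁻¹)
    (by rw [Module.finrank_fintype_fun_eq_card, hcard, Fintype.card_sigma]; simp [N])
    hμ (HermitePade.combinationCoeffs f m)
    (fun x t₀ h => HermitePade.eq_zero_of_combinationCoeffs_eq_zero hf h)
    (χ := fun t => (q (t + N)).reflect N)
    (fun t => by
      rw [hcard]
      exact Polynomial.natDegree_reflect_le.trans (max_le le_rfl (hden t).2.1))
    (by
      have h0 := hlimN 0
      rw [hQc] at h0
      -- Once the constant coefficient is nonzero it is the trailing one, so the normalization makes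
      -- it exactly $1$ and the reversed polynomial monic.
      filter_upwards [h0.eventually_ne one_ne_zero] with t ht
      have h1 := (hden t).2.2.2
      rw [Polynomial.trailingCoeff, Polynomial.natTrailingDegree_eq_zero.2 (Or.inr ht)] at h1
      rw [hcard, Polynomial.coeff_reflect, Polynomial.revAt_le le_rfl, Nat.sub_self, h1])
    (fun k => by
      rw [← hnodal]
      simp only [Polynomial.coeff_reflect]
      exact hlimN _)
    (Filter.Eventually.of_forall fun t x => by
      rw [HermitePade.combinationCoeffs, Fintype.linearCombination_apply, map_sum, Finset.sum_apply]
      refine Finset.sum_eq_zero fun σ _ => ?_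
      rw [map_smul, Pi.smul_apply, HermitePade.aeval_seqShift_reflect (hden t).2.1,
        (hden t).coeff_mul_eq_zero (hmN _ t) σ.2.2, smul_zero])
    ⟨ζ, Multiset.mem_toFinset.2 ((Polynomial.mem_roots hQne).2 hζ)⟩
  have hζ0 : ζ ≠ 0 := by
    rintro rfl
    rw [Polynomial.IsRoot, hQ0] at hζ
    exact one_ne_zero hζ
  simp only [HermitePade.combinationCoeffs_apply] at hx1 hx2
  exact ⟨hζ0, HermitePade.polyOfCoeffs x, HermitePade.degreesBelow_polyOfCoeffs x,
    HermitePade.isSingularPoint_of_tendsto_ratio hζ0 hx1 hx2⟩
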